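/- **Notation.** Let $\alpha>0$ and $m=[\alpha]+1$. For $\beta>0$ let $k^{\beta}(n)=\frac{\Gamma(\beta+n)}{\Gamma(\beta)\Gamma(n+1)}$, $n\in\mathbb{N}_0$. For a bounded linear operator $T$ on a complex Banach space $X$ put $$\Delta^{-\alpha}\mathcal{T}(n)=\sum_{j=0}^{n}k^{\alpha}(n-j)T^{j},\qquad M_T^{\alpha}(n)=\frac{1}{k^{\alpha+1}(n)}\Delta^{-\alpha}\mathcal{T}(n),\qquad n\in\mathbb{N}_0;$$ $T$ is *$(C,\alpha)$-bounded* if $\sup_n\|M_T^{\alpha}(n)\|<\infty$. For a complex sequence $(f(n))_{n\in\mathbb{Z}}$ let $W_+^{-\beta}f(n)=\sum_{j=n}^{\infty}k^{\beta}(j-n)f(j)$ and $W_-^{-\beta}f(n)=\sum_{j=-\infty}^{n}k^{\beta}(n-j)f(j)$ (whenever the series converge), and $$W_{\pm}^{\alpha}f(n)=\sum_{j=0}^{m}(-1)^{j}\binom{m}{j}\,\bigl(W_{\pm}^{-(m-\alpha)}f\bigr)(n\pm j).$$ Let $W^{\alpha}f(n)=W_+^{\alpha}f(n)$ for $n\ge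 0$ and $W^{\alpha}f(n)=W_-^{\alpha}f(n)$ for $n<0$. The *fractional Wiener algebra* $A^{\alpha}(\mathbb{T})$ consists of the continuous $2\pi$-periodic functions $\mathfrak{f}$, with Fourier coefficients $\widehat{\mathfrak f}(n)=\frac1{2\pi}\int_0^{2\pi}\mathfrak f(t)e^{-int}\,dt$, for which $W^{\alpha}\widehat{\mathfrak f}$ makes sense and $$\|\mathfrak f\|_{A^{\alpha}(\mathbb{T})}=\sum_{n=-\infty}^{\infty}|W^{\alpha}\widehat{\mathfrak f}(n)|\,k^{\alpha+1}(|n|)<\infty;$$ $A_+^{\alpha}(\mathbb{T})$ consists of those $\mathfrak f\in A^{\alpha}(\mathbb{T})$ with $\widehat{\mathfrak f}(n)=0$ for $n<0$. For a closed set $E\subseteq\mathbb{T}$ (with $t\in[0,2\pi)$ identified with $e^{it}$), a function $\mathfrak f\in A^{\alpha}(\mathbb{T})$ is *of spectral synthesis in $A^{\alpha}(\mathbb{T})$ with respect to $E$* if for every $\varepsilon>0$ there is $\mathfrak f_{\varepsilon}\in A^{\alpha}(\mathbb{T})$ with $\|\mathfrak f-\mathfrak f_{\varepsilon}\|_{A^{\alpha}(\mathbb{T})}<\varepsilon$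 and $\mathfrak f_{\varepsilon}=0$ in a neighborhood of $E$. **Theorem.** Let $\alpha>0$, let $T$ be a $(C,\alpha)$-bounded operator on a complex Banach space $X$, and let $\mathfrak f\in A_+^{\alpha}(\mathbb{T})$ be of spectral synthesis in $A^{\alpha}(\mathbb{T})$ with respect to $\sigma(T)\cap\mathbb{T}$. Then the series $$\theta_{\alpha}(\widehat{\mathfrak f})=\sum_{n=0}^{\infty}W_+^{\alpha}\widehat{\mathfrak f}(n)\,\Delta^{-\alpha}\mathcal{T}(n)$$ converges unconditionally in operator norm, and $$\lim_{n\to\infty}\|M_T^{\alpha}(n)\,\theta_{\alpha}(\widehat{\mathfrak f})\|=0.$$ -/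

import Mathlib

open scoped Topology

namespace CesaroKT

noncomputable section

/-- The Cesàro kernel `k^α(n) = Γ(α + n) / (Γ(α) Γ(n + 1))`, used for `α > 0`. -/
def cesaroKernel (α : ℝ) (n : ℕ) : ℝ :=
  Real.Gamma (α + n) / (Real.Gamma α * Real.Gamma (n + 1))

/-! ### Cesàro sums and Cesàro means of an operator -/

section Operator

variable {X : Type*} [NormedAddCommGroup X] [NormedSpace ℂ X]

/-- The Cesàro sum `Δ^{-α} 𝒯(n) = ∑_{j=0}^{n} k^α(n - j) T^j`. -/
def cesaroSum (α : ℝ) (T : X →L[ℂ] X) (n : ℕ) : X →L[ℂ] X :=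
  ∑ j ∈ Finset.range (n + 1), (cesaroKernel α (n - j) : ℂ) • T ^ j

/-- The Cesàro mean `M_T^α(n) = Δ^{-α} 𝒯(n) / k^{α+1}(n)`. -/
def cesaroMean (α : ℝ) (T : X →L[ℂ] X) (n : ℕ) : X →L[ℂ] X :=
  (1 / cesaroKernel (α + 1) n : ℂ) • cesaroSum α T n

/-- `T` is `(C, α)`-bounded: `sup_n ‖M_T^α(n)‖ < ∞`. -/
def IsCesaroBounded (α : ℝ) (T : X →L[ℂ] X) : Prop :=
  ∃ C : ℝ, ∀ n : ℕ, ‖cesaroMean α T n‖ ≤ C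

end Operator

/-! ### Weyl sums and Weyl differences of sequences on `ℤ`

The one-sided series are ordinary (possibly conditionally convergent) series, that is, limits of
their partial sums. -/

/-- The series `∑_{j ≥ n} k^β(j - n) f(j)` defining `W_+^{-β} f(n)` converges. -/
def WeylSumPlusConverges (β : ℝ) (f : ℤ → ℂ) (n : ℤ) : Prop :=
  Summable (fun i : ℕ => (cesaroKernel β i : ℂ) * f (n + i)) (SummationFilter.conditional ℕ)

/-- The series `∑_{j ≤ n} k^β(n - j) f(j)` defining `W_-^{-β} f(n)` converges. -/
def WeylSumMinusConverges (β : ℝ) (f : ℤ → ℂ) (n : ℤ) : Prop :=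
  Summable (fun i : ℕ => (cesaroKernel β i : ℂ) * f (n - i)) (SummationFilter.conditional ℕ)

/-- The Weyl sum `W_+^{-β} f(n) = ∑_{j ≥ n} k^β(j - n) f(j)`, written with `j = n + i`. -/
def weylSumPlus (β : ℝ) (f : ℤ → ℂ) (n : ℤ) : ℂ :=
  ∑'[SummationFilter.conditional ℕ] i : ℕ, (cesaroKernel β i : ℂ) * f (n + i)

/-- The Weyl sum `W_-^{-β} f(n) = ∑_{j ≤ n} k^β(n - j) f(j)`, written with `j = n - i`. -/
def weylSumMinus (β : ℝ) (f : ℤ → ℂ) (n : ℤ) : ℂ :=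
  ∑'[SummationFilter.conditional ℕ] i : ℕ, (cesaroKernel β i : ℂ) * f (n - i)

/-- `W_+^m f(n) = (-1)^m Δ^m f(n) = ∑_{j=0}^m (-1)^j (m choose j) f(n + j)`. -/
def natDiffPlus (m : ℕ) (f : ℤ → ℂ) (n : ℤ) : ℂ :=
  ∑ j ∈ Finset.range (m + 1), (-1 : ℂ) ^ j * (m.choose j : ℂ) * f (n + j)

/-- `W_-^m f(n) = ∇^m f(n) = ∑_{j=0}^m (-1)^j (m choose j) f(n - j)`. -/
def natDiffMinus (m : ℕ) (f : ℤ → ℂ) (n : ℤ) : ℂ :=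
  ∑ j ∈ Finset.range (m + 1), (-1 : ℂ) ^ j * (m.choose j : ℂ) * f (n - j)

/-- The integer `m = [α] + 1` entering the Weyl differences of order `α`. -/
def weylIndex (α : ℝ) : ℕ := ⌊α⌋₊ + 1

/-- The Weyl difference `W_+^α f = W_+^m W_+^{-(m - α)} f`, with `m = [α] + 1`. -/
def weylDiffPlus (α : ℝ) (f : ℤ → ℂ) (n : ℤ) : ℂ :=
  natDiffPlus (weylIndex α) (weylSumPlus (weylIndex α - α) f) n

/-- The Weyl difference `W_-^α f = W_-^m W_-^{-(m - α)} f`, with `m = [α] + 1`. -/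
def weylDiffMinus (α : ℝ) (f : ℤ → ℂ) (n : ℤ) : ℂ :=
  natDiffMinus (weylIndex α) (weylSumMinus (weylIndex α - α) f) n

/-- `W^α f(n)` is `W_+^α f(n)` for `n ≥ 0` and `W_-^α f(n)` for `n < 0`. -/
def weylDiff (α : ℝ) (f : ℤ → ℂ) (n : ℤ) : ℂ :=
  if 0 ≤ n then weylDiffPlus α f n else weylDiffMinus α f n

/-- The Weyl sums entering `W^α f(n)`, `n ∈ ℤ`, all converge. -/
def WeylDiffConverges (α : ℝ) (f : ℤ → ℂ) : Prop :=
  (∀ n : ℤ, 0 ≤ n → WeylSumPlusConverges (weylIndex α - α) f n) ∧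
    ∀ n : ℤ, n < 0 → WeylSumMinusConverges (weylIndex α - α) f n

/-! ### Fractional Wiener algebras

The circle `𝕋` is `AddCircle (2π) = ℝ / 2πℤ`; `t` corresponds to the point `e^{it}` of the unit circle
in `ℂ`, and Fourier coefficients are `𝔣̂(n) = (1/2π) ∫_0^{2π} 𝔣(t) e^{-int} dt`. -/

instance fact_two_pi_pos : Fact (0 < 2 * Real.pi) := ⟨Real.two_pi_pos⟩

/-- The sequence of Fourier coefficients of a continuous `2π`-periodic function. -/
def coeffs (f : C(AddCircle (2 * Real.pi), ℂ)) : ℤ → ℂ := fourierCoeff f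

/-- The norm `∑_{n ∈ ℤ} |W^α 𝔣̂(n)| k^{α+1}(|n|)` of the algebra `A^α(𝕋)`. -/
def wienerNorm (α : ℝ) (f : C(AddCircle (2 * Real.pi), ℂ)) : ℝ :=
  ∑' n : ℤ, ‖weylDiff α (coeffs f) n‖ * cesaroKernel (α + 1) n.natAbs

/-- Membership in `A^α(𝕋)`: `W^α 𝔣̂` makes sense and the norm of `A^α(𝕋)` is finite. -/
def MemWiener (α : ℝ) (f : C(AddCircle (2 * Real.pi), ℂ)) : Prop :=
  WeylDiffConverges α (coeffs f) ∧
    Summable fun n : ℤ => ‖weylDiff α (coeffs f) n‖ * cesaroKernel (α + 1) n.natAbs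

/-- Membership in `A_+^α(𝕋)`: in addition `𝔣̂(n) = 0` for `n < 0`. -/
def MemWienerPlus (α : ℝ) (f : C(AddCircle (2 * Real.pi), ℂ)) : Prop :=
  MemWiener α f ∧ ∀ n : ℤ, n < 0 → coeffs f n = 0

/-- `𝔣 ∈ A^α(𝕋)` is of spectral synthesis in `A^α(𝕋)` with respect to `E ⊆ 𝕋`. -/
def IsOfSpectralSynthesis (α : ℝ) (E : Set (AddCircle (2 * Real.pi)))
    (f : C(AddCircle (2 * Real.pi), ℂ)) : Prop :=
  MemWiener α f ∧ ∀ ε : ℝ, 0 < ε → ∃ g : C(AddCircle (2 * Real.pi), ℂ),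
    MemWiener α g ∧ wienerNorm α (f - g) < ε ∧ ∀ᶠ t in 𝓝ˢ E, g t = 0

section Calculus

variable {X : Type*} [NormedAddCommGroup X] [NormedSpace ℂ X]

/-- `σ(T) ∩ 𝕋`, as a subset of `ℝ / 2πℤ`: the set of all `t` with `e^{it} ∈ σ(T)`. -/
def unitarySpectrum (T : X →L[ℂ] X) : Set (AddCircle (2 * Real.pi)) :=
  {t | (AddCircle.toCircle t : ℂ) ∈ spectrum ℂ T}

/-- The terms `W_+^α f(n) Δ^{-α} 𝒯(n)` of the series defining `θ_α(f)`. -/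
def calculusTerm (α : ℝ) (T : X →L[ℂ] X) (f : ℤ → ℂ) (n : ℕ) : X →L[ℂ] X :=
  weylDiffPlus α f n • cesaroSum α T n

/-- The functional calculus `θ_α(f) = ∑_{n ≥ 0} W_+^α f(n) Δ^{-α} 𝒯(n)`. -/
def calculus (α : ℝ) (T : X →L[ℂ] X) (f : ℤ → ℂ) : X →L[ℂ] X :=
  ∑' n : ℕ, calculusTerm α T f n

end Calculus

end

end CesaroKT

namespace CesaroKT

/-! ### Cesàro kernels of real order and their generating series -/

open Filter Finset PowerSeries

/-! Suppose first that `g` vanishes near `σ(T) ∩ 𝕋`. Then `G(t) = g(t)(1 - e^{-it}T)^{-1}` is a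
continuous operator-valued function on the circle, so by Riemann–Lebesgue its coefficients `y_j =
Ĝ(-j)` tend to zero. The identity `G = g + e^{-it} T G` gives `y_{j+1} = ĝ(-(j+1)) + T y_j`, and
Abel summation identifies `y_0 = θ_α(g)`. As generating series, `∑ y_j z^j = (1 - zT)^{-1} S_g(z)`
with `S_g(z) = θ_α(g) + ∑_{d ≥ 1} ĝ(-d) z^d`. Multiplying by `(1 - z)^{-α}` turns `(1 - zT)^{-1}`
into the generating series of the Cesàro sums. Hence the `n`-th coefficient of the product with
`S_g` is `∑_j k^α(n - j) y_j`, which is `o(k^{α+1}(n))` (`tendsto_truncatedProduct`).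

For `f ∈ A_+^α(𝕋)` the series `S_f` is constant and the same coefficient is exactly `Δ^{-α}𝒯(n)
θ_α(f)`. The approximants `g` need not lie in `A_+^α(𝕋)`, which is why negative coefficients are
carried along. The coefficient is linear in the function and bounded by a constant times its norm
times `k^{α+1}(n)` (`norm_truncatedProduct_le`), so the limit passes from `g` to `f`.

Two analytic facts support this. Weyl differences of order `α` are inverted on null sequences by
`W_+^{-α}` (`weylConv_kernelSeries_inversion`), and the Cesàro sums of `rT`, `0 ≤ r ≤ 1`, obey the
same bound as those of `T` (`norm_cesaroSum_smul_le`), which dominates the Abel limit in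
`fourierCoeff_resolventMul_zero`. -/

/-- The Cesàro kernel of arbitrary real order, `∏_{i < n} (β + i) / (i + 1)`. -/
noncomputable def genKernel (β : ℝ) (n : ℕ) : ℝ := ∏ i ∈ range n, (β + i) / (i + 1)

@[simp] lemma genKernel_zero_right (β : ℝ) : genKernel β 0 = 1 := by simp [genKernel]

lemma genKernel_succ (β : ℝ) (n : ℕ) :
    genKernel β (n + 1) = genKernel β n * ((β + n) / (n + 1)) := by
  rw [genKernel, prod_range_succ, genKernel]

lemma succ_mul_genKernel_succ (β : ℝ) (n : ℕ) :
    ((n : ℝ) + 1) * genKernel β (n + 1) = (β + n) * genKernel β n := by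
  rw [genKernel_succ]; field_simp

lemma cesaroKernel_eq_genKernel {β : ℝ} (hβ : 0 < β) (n : ℕ) :
    cesaroKernel β n = genKernel β n := by
  have hG := (Real.Gamma_pos_of_pos hβ).ne'
  induction n with
  | zero => simp [cesaroKernel, hG]
  | succ n ih =>
    have hb : β + n ≠ 0 := by positivity
    have hn : (n : ℝ) + 1 ≠ 0 := by positivity
    have hG' := (Real.Gamma_pos_of_pos (by positivity : (0 : ℝ) < n + 1)).ne'
    rw [genKernel_succ, ← ih]
    simp only [cesaroKernel]
    push_cast
    rw [← add_assoc, Real.Gamma_add_one hb, Real.Gamma_add_one hn]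
    field_simp

lemma genKernel_pos {β : ℝ} (hβ : 0 < β) (n : ℕ) : 0 < genKernel β n :=
  prod_pos fun i _ => by positivity

lemma genKernel_sub_one_succ (β : ℝ) (n : ℕ) :
    genKernel (β - 1) (n + 1) = genKernel β (n + 1) - genKernel β n := by
  induction n with
  | zero => simp [genKernel]
  | succ n ih =>
    have h1 := succ_mul_genKernel_succ (β - 1) (n + 1)
    have h2 := succ_mul_genKernel_succ β (n + 1)
    have h3 := succ_mul_genKernel_succ β n
    push_cast at h1 h2
    have hn : (n : ℝ) + 1 + 1 ≠ 0 := by positivity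
    apply mul_left_cancel₀ hn
    rw [h1, ih]
    linear_combination h3 - h2

lemma genKernel_add_one_succ (β : ℝ) (n : ℕ) :
    genKernel (β + 1) (n + 1) = genKernel (β + 1) n + genKernel β (n + 1) := by
  have := genKernel_sub_one_succ (β + 1) n
  rw [add_sub_cancel_right] at this
  rw [this]; ring

lemma genKernel_le_add_one {β : ℝ} (hβ : 0 < β) (n : ℕ) :
    genKernel β n ≤ genKernel (β + 1) n := by
  cases n with
  | zero => simp
  | succ n =>
    rw [genKernel_add_one_succ]
    linarith [genKernel_pos (by linarith : 0 < β + 1) n]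

lemma monotone_genKernel_add_one {β : ℝ} (hβ : 0 < β) : Monotone (genKernel (β + 1)) :=
  monotone_nat_of_le_succ fun n => by
    rw [genKernel_add_one_succ]; linarith [genKernel_pos hβ (n + 1)]

lemma sum_genKernel (β : ℝ) (n : ℕ) :
    ∑ i ∈ range (n + 1), genKernel β i = genKernel (β + 1) n := by
  induction n with
  | zero => simp
  | succ n ih => rw [sum_range_succ, ih, genKernel_add_one_succ]

lemma mul_genKernel_add_one (β : ℝ) (n : ℕ) :
    β * genKernel (β + 1) n = (β + n) * genKernel β n := by
  induction n with
  | zero => simp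
  | succ n ih =>
    rw [genKernel_add_one_succ, mul_add, ih, ← succ_mul_genKernel_succ]
    push_cast; ring

/-- The power series `(1 - z)^{-β}`. -/
noncomputable def kernelSeries (β : ℝ) : PowerSeries ℝ := PowerSeries.mk (genKernel β)

@[simp] lemma coeff_kernelSeries (β : ℝ) (n : ℕ) : coeff n (kernelSeries β) = genKernel β n :=
  coeff_mk _ _

@[simp] lemma constantCoeff_kernelSeries (β : ℝ) : constantCoeff (kernelSeries β) = 1 := by
  rw [← coeff_zero_eq_constantCoeff_apply]; simp

lemma coeff_succ_one_sub_X_mul (φ : PowerSeries ℝ) (n : ℕ) :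
    coeff (n + 1) ((1 - X) * φ) = coeff (n + 1) φ - coeff n φ := by
  rw [sub_mul, one_mul, map_sub, coeff_succ_X_mul]

lemma one_sub_X_mul_kernelSeries (β : ℝ) :
    (1 - X) * kernelSeries β = kernelSeries (β - 1) := by
  ext n
  cases n with
  | zero => simp [sub_mul]
  | succ n => simp [coeff_succ_one_sub_X_mul, genKernel_sub_one_succ]

lemma one_sub_X_mul_derivative_kernelSeries (β : ℝ) :
    (1 - X) * derivative ℝ (kernelSeries β) = C β * kernelSeries β := by
  ext n
  rw [coeff_C_mul, coeff_kernelSeries]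
  cases n with
  | zero =>
    rw [sub_mul, one_mul, map_sub, coeff_zero_X_mul, sub_zero, coeff_derivative]
    simp [genKernel]
  | succ n =>
    rw [coeff_succ_one_sub_X_mul]
    simp only [coeff_derivative, coeff_kernelSeries]
    have h2 := succ_mul_genKernel_succ β (n + 1)
    push_cast at h2 ⊢
    linear_combination h2

/-- The equation `(1 - z) φ' = β φ` characterises the multiples of `(1 - z)^{-β}`. -/
lemma eq_kernelSeries_of_derivative {β : ℝ} {φ : PowerSeries ℝ}
    (h : (1 - X) * derivative ℝ φ = C β * φ) (h0 : coeff 0 φ = 1) : φ = kernelSeries β := by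
  ext n
  rw [coeff_kernelSeries]
  induction n with
  | zero => simpa using h0
  | succ n ih =>
    have hn : (n : ℝ) + 1 ≠ 0 := by positivity
    apply mul_left_cancel₀ hn
    rw [succ_mul_genKernel_succ, ← ih]
    have := congrArg (coeff n) h
    rw [coeff_C_mul] at this
    cases n with
    | zero =>
      rw [sub_mul, one_mul, map_sub, coeff_zero_X_mul, sub_zero, coeff_derivative] at this
      push_cast at this ⊢
      linear_combination this
    | succ n =>
      rw [coeff_succ_one_sub_X_mul, coeff_derivative, coeff_derivative] at this
      push_cast at this ⊢
      linear_combination this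

/-- By the product rule the left side solves the first-order equation characterising the right side,
with constant term 1. -/
lemma kernelSeries_mul (β γ : ℝ) :
    kernelSeries β * kernelSeries γ = kernelSeries (β + γ) := by
  apply eq_kernelSeries_of_derivative
  · rw [Derivation.leibniz, smul_eq_mul, smul_eq_mul, map_add]
    linear_combination kernelSeries γ * one_sub_X_mul_derivative_kernelSeries β +
      kernelSeries β * one_sub_X_mul_derivative_kernelSeries γ
  · simp [coeff_mul]

lemma kernelSeries_zero : kernelSeries 0 = 1 := by
  symm
  apply eq_kernelSeries_of_derivative <;> simp

/-! ### Summability of kernels -/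

lemma genKernel_neg_nonpos {γ : ℝ} (h0 : 0 ≤ γ) (h1 : γ ≤ 1) (n : ℕ) :
    genKernel (-γ) (n + 1) ≤ 0 := by
  induction n with
  | zero => simp [genKernel, h0]
  | succ n ih =>
    rw [genKernel_succ]
    refine mul_nonpos_of_nonpos_of_nonneg ih (div_nonneg ?_ (by positivity))
    push_cast
    have : (0 : ℝ) ≤ n := n.cast_nonneg
    linarith

lemma genKernel_nonneg {β : ℝ} (hβ : 0 ≤ β) (n : ℕ) : 0 ≤ genKernel β n :=
  prod_nonneg fun i _ => by positivity

/-- All terms after the zeroth are nonpositive, so their absolute partial sums equal `1 - k^{1-γ}(n)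
≤ 1`. -/
lemma summable_norm_genKernel_neg_of_le_one {γ : ℝ} (h0 : 0 ≤ γ) (h1 : γ ≤ 1) :
    Summable fun n => ‖genKernel (-γ) n‖ := by
  rw [← summable_nat_add_iff 1]
  refine summable_of_sum_range_le (c := 1) (fun _ => norm_nonneg _) fun n => ?_
  have hs := sum_genKernel (-γ) n
  rw [sum_range_succ'] at hs
  have : ∑ i ∈ range n, ‖genKernel (-γ) (i + 1)‖ = -∑ i ∈ range n, genKernel (-γ) (i + 1) := by
    rw [← sum_neg_distrib]
    exact sum_congr rfl fun i _ => by
      rw [Real.norm_eq_abs, abs_of_nonpos (genKernel_neg_nonpos h0 h1 i)]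
  rw [this]
  have := genKernel_nonneg (by linarith : 0 ≤ -γ + 1) n
  simp only [genKernel_zero_right] at hs
  linarith

lemma summable_norm_genKernel_sub_one {β : ℝ} (h : Summable fun n => ‖genKernel β n‖) :
    Summable fun n => ‖genKernel (β - 1) n‖ := by
  rw [← summable_nat_add_iff 1]
  refine Summable.of_nonneg_of_le (fun _ => norm_nonneg _) (fun n => ?_)
    (((summable_nat_add_iff 1).2 h).add h)
  rw [genKernel_sub_one_succ]
  exact norm_sub_le _ _

/-- Start from the fractional part of `γ`; each further factor `1 - z` preserves absolute
summability. -/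
lemma summable_norm_genKernel_neg {γ : ℝ} (h0 : 0 ≤ γ) :
    Summable fun n => ‖genKernel (-γ) n‖ := by
  have key : ∀ m : ℕ, ∀ δ : ℝ, 0 ≤ δ → δ ≤ 1 → Summable fun n => ‖genKernel (-δ - m) n‖ := by
    intro m δ hδ hδ'
    induction m with
    | zero => simpa using summable_norm_genKernel_neg_of_le_one hδ hδ'
    | succ m ih =>
      have := summable_norm_genKernel_sub_one ih
      convert this using 4
      push_cast; ring
  have := key ⌊γ⌋₊ (γ - ⌊γ⌋₊) (by linarith [Nat.floor_le h0])
    (by linarith [(Nat.lt_floor_add_one γ).le])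
  simpa using this

lemma summable_mul_pow_genKernel {β r : ℝ} (hβ : 0 < β) (h0 : 0 < r) (h1 : r < 1) :
    Summable fun n => r ^ n * genKernel β n := by
  refine summable_of_ratio_test_tendsto_lt_one h1
    (.of_forall fun n => (mul_pos (pow_pos h0 n) (genKernel_pos hβ n)).ne') ?_
  have h : ∀ n : ℕ, ‖r ^ (n + 1) * genKernel β (n + 1)‖ / ‖r ^ n * genKernel β n‖
      = r * (1 + (β - 1) * (1 / ((n : ℝ) + 1))) := by
    intro n
    have hk := genKernel_pos hβ n
    rw [Real.norm_of_nonneg (mul_pos (pow_pos h0 _) (genKernel_pos hβ _)).le,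
      Real.norm_of_nonneg (mul_pos (pow_pos h0 _) hk).le, genKernel_succ]
    field_simp
    ring
  simp only [h]
  have := ((tendsto_one_div_add_atTop_nhds_zero_nat (𝕜 := ℝ)).const_mul (β - 1)).const_add 1
  simpa using this.const_mul r

/-- A regular summation method: `k^α`-weighted averages of a null sequence tend to zero. -/
lemma tendsto_genKernel_average {α : ℝ} (hα : 0 < α) {u : ℕ → ℝ} (hu0 : ∀ n, 0 ≤ u n)
    (hu : Tendsto u atTop (𝓝 0)) :
    Tendsto (fun n => (∑ j ∈ range (n + 1), genKernel α (n - j) * u j) / genKernel (α + 1) n)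
      atTop (𝓝 0) := by
  have hk : ∀ n, 0 < genKernel (α + 1) n := genKernel_pos (by linarith)
  -- With `m = n - j`, the ratio `k^α(m) / k^{α+1}(m)` is `α / (α + m)`, and `k^{α+1}(m) ≤
  -- k^{α+1}(n)`.
  have hterm : ∀ j, Tendsto (fun n => genKernel α (n - j) / genKernel (α + 1) n)
      atTop (𝓝 0) := by
    intro j
    have h0 : Tendsto (fun n : ℕ => α / (α + (n - j : ℕ))) atTop (𝓝 0) := by
      refine Tendsto.div_atTop tendsto_const_nhds (tendsto_atTop_add_const_left _ _ ?_)
      exact tendsto_natCast_atTop_atTop.comp (tendsto_sub_atTop_nat j)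
    refine squeeze_zero (fun n => div_nonneg (genKernel_pos hα _).le (hk n).le) (fun n => ?_) h0
    rw [div_le_div_iff₀ (hk n) (by positivity), mul_comm, ← mul_genKernel_add_one]
    exact mul_le_mul_of_nonneg_left (monotone_genKernel_add_one hα (n.sub_le j)) hα.le
  rw [Metric.tendsto_atTop]
  intro ε hε
  obtain ⟨N, hN⟩ := (hu.eventually (gt_mem_nhds (half_pos hε))).exists_forall_of_atTop
  have hfin : Tendsto (fun n => ∑ j ∈ range N, genKernel α (n - j) / genKernel (α + 1) n * u j)
      atTop (𝓝 0) := by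
    have := tendsto_finsetSum (range N) fun j _ => (hterm j).mul_const (u j)
    simpa using this
  obtain ⟨M, hM⟩ := (hfin.eventually (gt_mem_nhds (half_pos hε))).exists_forall_of_atTop
  refine ⟨max M N, fun n hn => ?_⟩
  have hnM : M ≤ n := le_trans (le_max_left _ _) hn
  have hnN : N ≤ n + 1 := le_trans (le_trans (le_max_right _ _) hn) n.le_succ
  rw [Real.dist_eq, sub_zero, abs_of_nonneg (div_nonneg
    (sum_nonneg fun j _ => mul_nonneg (genKernel_pos hα _).le (hu0 j)) (hk n).le)]
  have hsplit := sum_range_add_sum_Ico (fun j => genKernel α (n - j) * u j) hnN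
  have h2 : ∑ j ∈ Ico N (n + 1), genKernel α (n - j) * u j ≤ ε / 2 * genKernel (α + 1) n := by
    calc _ ≤ ∑ j ∈ Ico N (n + 1), genKernel α (n - j) * (ε / 2) := by
          refine sum_le_sum fun j hj => ?_
          exact mul_le_mul_of_nonneg_left (hN j (mem_Ico.1 hj).1).le (genKernel_pos hα _).le
      _ ≤ ∑ j ∈ range (n + 1), genKernel α (n - j) * (ε / 2) := by
          refine sum_le_sum_of_subset_of_nonneg (fun j hj => ?_) fun j _ _ =>
            mul_nonneg (genKernel_pos hα _).le (half_pos hε).le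
          exact mem_range.2 (mem_Ico.1 hj).2
      _ = _ := by
          rw [← sum_mul, ← sum_genKernel, ← sum_range_reflect (genKernel α), mul_comm]
          simp
  have h1 := hM n hnM
  simp only [div_mul_eq_mul_div, ← sum_div] at h1
  rw [div_lt_iff₀ (hk n)] at h1 ⊢
  rw [← hsplit]
  linarith

/-! ### Power series in the backward shift and inversion of Weyl differences -/

lemma summable_sigma_antidiagonal {E : Type*} [AddCommMonoid E] [TopologicalSpace E]
    {F : ℕ × ℕ → E} (hF : Summable F) :
    Summable fun x : Σ n : ℕ, antidiagonal n => F x.2.1 :=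
  (HasAntidiagonal.sigmaAntidiagonalEquivProd.summable_iff (f := F)).2 hF

lemma tsum_tsum_eq_tsum_sum_antidiagonal {E : Type*} [NormedAddCommGroup E] [CompleteSpace E]
    {F : ℕ × ℕ → E} (hF : Summable F) :
    ∑' i, ∑' j, F (i, j) = ∑' n, ∑ p ∈ antidiagonal n, F p := by
  rw [← hF.tsum_prod, ← HasAntidiagonal.sigmaAntidiagonalEquivProd.tsum_eq F]
  refine ((summable_sigma_antidiagonal hF).tsum_sigma).trans (tsum_congr fun n => ?_)
  rw [tsum_fintype]
  exact (antidiagonal n).sum_coe_sort F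

/-- The index map `(i, l) ↦ (i, n + i + l)` is injective, so this is a subfamily of an absolutely
summable product family. -/
lemma summable_mul_shift {u w : ℕ → ℝ} (hu : Summable fun n => ‖u n‖)
    (hw : Summable fun n => ‖w n‖) (n : ℕ) :
    Summable fun p : ℕ × ℕ => u p.1 * w (n + p.1 + p.2) := by
  have hinj : Function.Injective fun p : ℕ × ℕ => (p.1, n + p.1 + p.2) := by
    rintro ⟨i, l⟩ ⟨i', l'⟩ h
    simp only [Prod.mk.injEq] at h
    ext <;> simp only <;> omega
  exact (summable_mul_of_summable_norm hu hw).comp_injective hinj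

/-- The action `∑_i φ_i a(n + i)` of a power series `φ`, evaluated at the backward shift, on a
sequence `a`. -/
noncomputable def weylConv (φ : PowerSeries ℝ) (a : ℕ → ℂ) (n : ℕ) : ℂ :=
  ∑' i, ((coeff i φ : ℝ) : ℂ) * a (n + i)

lemma weylConv_weylConv {φ ψ : PowerSeries ℝ} {a : ℕ → ℂ} {n : ℕ}
    (h : Summable fun p : ℕ × ℕ =>
      ((coeff p.1 φ : ℝ) : ℂ) * (((coeff p.2 ψ : ℝ) : ℂ) * a (n + p.1 + p.2))) :
    weylConv φ (weylConv ψ a) n = weylConv (φ * ψ) a n := by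
  simp only [weylConv, ← tsum_mul_left]
  rw [tsum_tsum_eq_tsum_sum_antidiagonal h]
  refine tsum_congr fun k => ?_
  rw [coeff_mul]
  push_cast
  rw [sum_mul]
  refine sum_congr rfl fun p hp => ?_
  rw [← mem_antidiagonal.1 hp, add_assoc, mul_assoc]

lemma weylConv_one (a : ℕ → ℂ) : weylConv 1 a = a := by
  funext n
  rw [weylConv, tsum_eq_single 0]
  · simp
  · intro i hi; simp [coeff_one, hi]

lemma summable_norm_weylConv {φ : PowerSeries ℝ} {a : ℕ → ℂ} {M : ℝ}
    (hφ : Summable fun i => ‖coeff i φ‖) (ha : ∀ n, ‖a n‖ ≤ M) (n : ℕ) :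
    Summable fun i => ‖((coeff i φ : ℝ) : ℂ) * a (n + i)‖ := by
  refine Summable.of_nonneg_of_le (fun _ => norm_nonneg _) (fun i => ?_) (hφ.mul_right M)
  rw [norm_mul, Complex.norm_real]
  exact mul_le_mul_of_nonneg_left (ha _) (norm_nonneg _)

lemma weylConv_weylConv_of_bounded {φ ψ : PowerSeries ℝ} {a : ℕ → ℂ} {M : ℝ}
    (hφ : Summable fun i => ‖coeff i φ‖) (hψ : Summable fun i => ‖coeff i ψ‖)
    (ha : ∀ n, ‖a n‖ ≤ M) (n : ℕ) :
    weylConv φ (weylConv ψ a) n = weylConv (φ * ψ) a n := by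
  apply weylConv_weylConv
  refine Summable.of_norm_bounded
    (g := fun p : ℕ × ℕ => ‖coeff p.1 φ‖ * ‖coeff p.2 ψ‖ * M) ?_ fun p => ?_
  · refine Summable.mul_right M (summable_mul_of_summable_norm
      (f := fun i => ‖coeff i φ‖) (g := fun i => ‖coeff i ψ‖) ?_ ?_) <;> simpa
  · rw [norm_mul, norm_mul, Complex.norm_real, Complex.norm_real, mul_assoc]
    gcongr
    exact ha _

lemma weylConv_sub {φ : PowerSeries ℝ} {a a' : ℕ → ℂ} {M M' : ℝ}
    (hφ : Summable fun i => ‖coeff i φ‖) (ha : ∀ n, ‖a n‖ ≤ M) (ha' : ∀ n, ‖a' n‖ ≤ M')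
    (n : ℕ) : weylConv φ (fun k => a k - a' k) n = weylConv φ a n - weylConv φ a' n := by
  rw [weylConv, weylConv, weylConv, ← (summable_norm_weylConv hφ ha n).of_norm.tsum_sub
    (summable_norm_weylConv hφ ha' n).of_norm]
  exact tsum_congr fun i => by ring

lemma weylConv_one_sub_X_mul {φ : PowerSeries ℝ} {a : ℕ → ℂ} {M : ℝ}
    (hφ : Summable fun i => ‖coeff i φ‖) (ha : ∀ n, ‖a n‖ ≤ M) (n : ℕ) :
    weylConv ((1 - X) * φ) a n = weylConv φ a n - weylConv φ a (n + 1) := by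
  have h0 := (summable_norm_weylConv hφ ha n).of_norm
  have h1 := (summable_norm_weylConv hφ ha (n + 1)).of_norm
  have h0' := (summable_nat_add_iff 1).2 h0
  have key : ∀ i, ((coeff (i + 1) ((1 - X) * φ) : ℝ) : ℂ) * a (n + (i + 1)) =
      ((coeff (i + 1) φ : ℝ) : ℂ) * a (n + (i + 1)) - ((coeff i φ : ℝ) : ℂ) * a (n + 1 + i) := by
    intro i
    rw [coeff_succ_one_sub_X_mul, show n + 1 + i = n + (i + 1) by ring]
    push_cast; ring
  have hs : Summable fun i => ((coeff i ((1 - X) * φ) : ℝ) : ℂ) * a (n + i) := by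
    rw [← summable_nat_add_iff 1]
    exact (h0'.sub h1).congr fun i => (key i).symm
  rw [weylConv, hs.tsum_eq_zero_add, tsum_congr key, h0'.tsum_sub h1, weylConv,
    h0.tsum_eq_zero_add, weylConv]
  simp [sub_mul]
  ring

lemma tendsto_weylConv {φ : PowerSeries ℝ} {a : ℕ → ℂ} {M : ℝ}
    (hφ : Summable fun i => ‖coeff i φ‖) (hM : ∀ n, ‖a n‖ ≤ M) (ha : Tendsto a atTop (𝓝 0)) :
    Tendsto (weylConv φ a) atTop (𝓝 0) := by
  have := tendsto_tsum_of_dominated_convergence (𝓕 := atTop)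
    (f := fun n i => ((coeff i φ : ℝ) : ℂ) * a (n + i)) (g := fun _ => 0)
    (bound := fun i => ‖coeff i φ‖ * M) (hφ.mul_right M) (fun i => by
      simpa using ((tendsto_add_atTop_iff_nat i).2 ha).const_mul ((coeff i φ : ℝ) : ℂ))
    (.of_forall fun n i => by
      rw [norm_mul, Complex.norm_real]
      exact mul_le_mul_of_nonneg_left (hM _) (norm_nonneg _))
  rwa [tsum_zero] at this

lemma summable_norm_coeff_kernelSeries_neg {γ : ℝ} (hγ : 0 ≤ γ) :
    Summable fun i => ‖coeff i (kernelSeries (-γ))‖ := by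
  simpa using summable_norm_genKernel_neg hγ

/-- A null sequence is determined by its differences of order `m`. -/
lemma eq_zero_of_weylConv_eq_zero {a : ℕ → ℂ} (ha : Tendsto a atTop (𝓝 0)) {M : ℝ}
    (hM : ∀ n, ‖a n‖ ≤ M) (m : ℕ) (h : ∀ n, weylConv (kernelSeries (-(m : ℝ))) a n = 0) (n : ℕ) :
    a n = 0 := by
  induction m generalizing n with
  | zero => simpa [kernelSeries_zero, weylConv_one] using h n
  | succ m ih =>
    have hs := summable_norm_coeff_kernelSeries_neg (Nat.cast_nonneg (α := ℝ) m)
    refine ih (fun k => ?_) n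
    -- A vanishing difference of order `m + 1` makes the difference of order `m` constant; being
    -- null, it is zero.
    have hstep : ∀ k, weylConv (kernelSeries (-(m : ℝ))) a (k + 1) =
        weylConv (kernelSeries (-(m : ℝ))) a k := by
      intro k
      have h' := h k
      rw [show (-((m + 1 : ℕ) : ℝ)) = -(m : ℝ) - 1 by push_cast; ring,
        ← one_sub_X_mul_kernelSeries, weylConv_one_sub_X_mul hs hM] at h'
      exact (sub_eq_zero.1 h').symm
    have hconst : ∀ j, weylConv (kernelSeries (-(m : ℝ))) a (j + k) =
        weylConv (kernelSeries (-(m : ℝ))) a k := by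
      intro j
      induction j with
      | zero => simp
      | succ j ihj => rw [← ihj, ← hstep (j + k)]; congr 1; ring
    have ht := (tendsto_add_atTop_iff_nat k).2 (tendsto_weylConv hs hM ha)
    simp only [hconst] at ht
    exact tendsto_nhds_unique tendsto_const_nhds ht

lemma exists_norm_le_of_tendsto {a : ℕ → ℂ} {l : ℂ} (ha : Tendsto a atTop (𝓝 l)) :
    ∃ M, ∀ n, ‖a n‖ ≤ M := by
  obtain ⟨M, hM⟩ := ha.norm.bddAbove_range
  exact ⟨M, fun n => hM ⟨n, rfl⟩⟩

/-- The weight `k^{α+1}` absorbs the kernel `k^α` under every shift; this gives absolute convergence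
of `W_+^{-α} b` and control by tails of the weighted sum. -/
lemma norm_genKernel_mul_le {α : ℝ} (hα : 0 < α) (b : ℕ → ℂ) (n i : ℕ) :
    genKernel α i * ‖b (n + i)‖ ≤ ‖b (n + i)‖ * genKernel (α + 1) (n + i) := by
  rw [mul_comm]
  gcongr
  exact (genKernel_le_add_one hα i).trans (monotone_genKernel_add_one hα (Nat.le_add_left i n))

/-- Inversion of the Weyl difference of order `α` on null sequences. -/
theorem weylConv_kernelSeries_inversion {α : ℝ} (hα : 0 < α) {a : ℕ → ℂ}
    (ha : Tendsto a atTop (𝓝 0))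
    (hb : Summable fun j => ‖weylConv (kernelSeries (-α)) a j‖ * genKernel (α + 1) j) (n : ℕ) :
    weylConv (kernelSeries α) (weylConv (kernelSeries (-α)) a) n = a n := by
  obtain ⟨M, hM⟩ := exists_norm_le_of_tendsto ha
  set b := weylConv (kernelSeries (-α)) a with hbdef
  have hs := summable_norm_coeff_kernelSeries_neg hα.le
  have hterm : ∀ n i, ‖((coeff i (kernelSeries α) : ℝ) : ℂ) * b (n + i)‖ ≤
      ‖b (i + n)‖ * genKernel (α + 1) (i + n) := by
    intro n i
    rw [norm_mul, Complex.norm_real, coeff_kernelSeries,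
      Real.norm_of_nonneg (genKernel_pos hα i).le, add_comm i n]
    exact norm_genKernel_mul_le hα b n i
  have ht : Tendsto (weylConv (kernelSeries α) b) atTop (𝓝 0) := by
    refine squeeze_zero_norm (fun n => ?_)
      (tendsto_sum_nat_add fun j => ‖b j‖ * genKernel (α + 1) j)
    exact tsum_of_norm_bounded ((summable_nat_add_iff n).2 hb).hasSum (hterm n)
  obtain ⟨M', hM'⟩ := exists_norm_le_of_tendsto ht
  -- Since `a` is only null, `W_+^{-α} W_+^α a` cannot be rearranged directly. In the opposite order
  -- the double series does converge absolutely, so `W_+^{-α} b - a` is a null sequence killed by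
  -- `W_+^α`.
  have hinv : ∀ n, weylConv (kernelSeries (-α)) (weylConv (kernelSeries α) b) n = b n := by
    intro n
    rw [weylConv_weylConv, kernelSeries_mul, neg_add_cancel, kernelSeries_zero, weylConv_one]
    have hb' : Summable fun j => ‖‖b j‖ * genKernel (α + 1) j‖ := hb.norm
    refine Summable.of_norm_bounded (summable_mul_shift
      (u := fun i => ‖coeff i (kernelSeries (-α))‖) (by simpa using hs) hb' n) fun p => ?_
    rw [norm_mul, Complex.norm_real]
    refine mul_le_mul_of_nonneg_left ?_ (norm_nonneg _)
    simpa only [add_comm] using hterm (n + p.1) p.2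
  have hc : Tendsto (fun k => weylConv (kernelSeries α) b k - a k) atTop (𝓝 0) := by
    simpa using ht.sub ha
  obtain ⟨M'', hM''⟩ := exists_norm_le_of_tendsto hc
  have hzero : ∀ k, weylConv (kernelSeries (-α))
      (fun k => weylConv (kernelSeries α) b k - a k) k = 0 := by
    intro k
    rw [weylConv_sub hs hM' hM, hinv, hbdef, sub_self]
  -- A further difference of order `[α] + 1 - α` raises the order to an integer, where null
  -- sequences are known to be determined by their differences.
  refine sub_eq_zero.1 (eq_zero_of_weylConv_eq_zero hc hM'' (⌊α⌋₊ + 1) (fun k => ?_) n)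
  have hγ : 0 ≤ ((⌊α⌋₊ + 1 : ℕ) : ℝ) - α := by
    push_cast; linarith [Nat.lt_floor_add_one α]
  have := weylConv_weylConv_of_bounded (summable_norm_coeff_kernelSeries_neg hγ) hs hM'' k
  rw [kernelSeries_mul, show -(((⌊α⌋₊ + 1 : ℕ) : ℝ) - α) + -α = -((⌊α⌋₊ + 1 : ℕ) : ℝ) by ring]
    at this
  rw [← this, funext hzero]
  simp [weylConv]

/-! ### Weyl differences -/

lemma natDiffPlus_succ (m : ℕ) (f : ℤ → ℂ) (n : ℤ) :
    natDiffPlus (m + 1) f n = natDiffPlus m (fun k => f k - f (k + 1)) n := by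
  have key : ∀ (m : ℕ) (f : ℤ → ℂ), natDiffPlus m f n = (-1) ^ m * (fwdDiff 1)^[m] f n := by
    intro m f
    rw [fwdDiff_iter_eq_sum_shift, natDiffPlus, mul_sum]
    refine sum_congr rfl fun j hj => ?_
    have hj' : j ≤ m := by simpa [Nat.lt_succ_iff] using hj
    have h1 : (-1 : ℂ) ^ m * (-1) ^ (m - j) = (-1) ^ j := by
      obtain ⟨d, rfl⟩ := Nat.exists_eq_add_of_le hj'
      rw [Nat.add_sub_cancel_left, pow_add, mul_assoc, ← mul_pow]; simp
    rw [← h1]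
    simp
    ring
  have hneg : (fun k => f k - f (k + 1)) = (-1 : ℂ) • fwdDiff 1 f := by
    funext k; simp [fwdDiff]
  rw [key, key, hneg, fwdDiff_iter_const_smul, Function.iterate_succ_apply, pow_succ]
  simp

/-- Each first difference multiplies the acting power series by `1 - z`, raising `γ` by one. -/
lemma natDiffPlus_eq_weylConv (m : ℕ) {φ : PowerSeries ℝ} {a : ℕ → ℂ} {M : ℝ} {f : ℤ → ℂ} {γ : ℝ}
    (hφ : φ = kernelSeries (-γ)) (hγ : 0 ≤ γ) (ha : ∀ n, ‖a n‖ ≤ M)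
    (hf : ∀ n : ℕ, f n = weylConv φ a n) (n : ℕ) :
    natDiffPlus m f n = weylConv (kernelSeries (-γ - m)) a n := by
  induction m generalizing f φ γ with
  | zero => simp [natDiffPlus, hf, hφ]
  | succ m ih =>
    rw [natDiffPlus_succ, ih (φ := (1 - X) * φ) (γ := γ + 1)]
    · congr 2; push_cast; ring
    · rw [hφ, one_sub_X_mul_kernelSeries]; congr 1; ring
    · linarith
    · intro k
      rw [weylConv_one_sub_X_mul (hφ ▸ summable_norm_coeff_kernelSeries_neg hγ) ha, hf k,
        ← hf (k + 1)]
      push_cast; rfl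

lemma WeylSumPlusConverges.tendsto {β : ℝ} {f : ℤ → ℂ} {n : ℤ}
    (h : WeylSumPlusConverges β f n) :
    Tendsto (fun N => ∑ i ∈ range N, (cesaroKernel β i : ℂ) * f (n + i)) atTop
      (𝓝 (weylSumPlus β f n)) := by
  have := Summable.hasSum h
  rwa [HasSum, SummationFilter.conditional_filter_eq_map_range, tendsto_map'_iff] at this

/-- The Weyl sums may converge only conditionally, but a single difference replaces `k^β` by the
absolutely summable `k^{β-1}`. Partial sums are compared with `N + 1` terms at `n` against `N` terms
at `n + 1`. -/
lemma weylSumPlus_sub_succ {β : ℝ} (hβ : 0 < β) (hβ1 : β ≤ 1) {f : ℤ → ℂ} {M : ℝ}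
    (hM : ∀ n : ℕ, ‖f n‖ ≤ M) (hf : ∀ n : ℤ, 0 ≤ n → WeylSumPlusConverges β f n) (n : ℕ) :
    weylSumPlus β f n - weylSumPlus β f (n + 1) =
      weylConv (kernelSeries (-(1 - β))) (fun k : ℕ => f k) n := by
  have h0 := (tendsto_add_atTop_iff_nat 1).2 (hf n (by positivity)).tendsto
  have h1 := (hf (n + 1) (by positivity)).tendsto
  have h2 := (tendsto_add_atTop_iff_nat 1).2 (summable_norm_weylConv
    (summable_norm_coeff_kernelSeries_neg (by linarith : 0 ≤ 1 - β)) (a := fun k : ℕ => f k)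
    hM n).of_norm.hasSum.tendsto_sum_nat
  refine tendsto_nhds_unique (h0.sub h1) (h2.congr fun N => ?_)
  rw [sum_range_succ', sum_range_succ', add_sub_right_comm, ← sum_sub_distrib]
  simp only [cesaroKernel_eq_genKernel hβ, coeff_kernelSeries]
  congr 1
  · refine sum_congr rfl fun i _ => ?_
    rw [show -(1 - β) = β - 1 by ring, genKernel_sub_one_succ]
    push_cast
    rw [show (n : ℤ) + 1 + i = n + (i + 1) by ring]
    ring

/-- For bounded sequences, the Weyl difference is the absolutely convergent series
`∑_i k^{-α}(i) f(n + i)`. -/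
theorem weylDiffPlus_eq_weylConv {α : ℝ} (hα : 0 < α) {f : ℤ → ℂ} {M : ℝ}
    (hM : ∀ n : ℕ, ‖f n‖ ≤ M)
    (hf : ∀ n : ℤ, 0 ≤ n → WeylSumPlusConverges (weylIndex α - α) f n) (n : ℕ) :
    weylDiffPlus α f n = weylConv (kernelSeries (-α)) (fun k : ℕ => f k) n := by
  have hw : (weylIndex α : ℝ) = ⌊α⌋₊ + 1 := by simp [weylIndex]
  have hβ : 0 < (weylIndex α : ℝ) - α := by rw [hw]; linarith [Nat.lt_floor_add_one α]
  have hβ1 : (weylIndex α : ℝ) - α ≤ 1 := by rw [hw]; linarith [Nat.floor_le hα.le]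
  -- One of the `[α] + 1` differences is spent on reaching absolute convergence; the other `[α]` act
  -- on the resulting series.
  rw [weylDiffPlus, weylIndex, natDiffPlus_succ,
    natDiffPlus_eq_weylConv ⌊α⌋₊ rfl (by linarith : 0 ≤ 1 - ((weylIndex α : ℝ) - α)) hM]
  · congr 2; rw [hw]; ring
  · intro k
    exact weylSumPlus_sub_succ hβ hβ1 hM hf k

/-- The reflection `k ↦ -1 - k` maps the negative integers onto `ℕ` and reduces the minus theory to
the plus theory. -/
lemma weylSumMinus_eq (β : ℝ) (f : ℤ → ℂ) (n : ℤ) :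
    weylSumMinus β f (-1 - n) = weylSumPlus β (fun k => f (-1 - k)) n := by
  simp only [weylSumMinus, weylSumPlus]
  congr 1; funext i; congr 2; ring

lemma weylDiffMinus_eq (α : ℝ) (f : ℤ → ℂ) (n : ℤ) :
    weylDiffMinus α f (-1 - n) = weylDiffPlus α (fun k => f (-1 - k)) n := by
  simp only [weylDiffMinus, weylDiffPlus, natDiffMinus, natDiffPlus]
  refine sum_congr rfl fun j _ => ?_
  rw [← weylSumMinus_eq]
  congr 2; ring

lemma weylSumMinusConverges_iff (β : ℝ) (f : ℤ → ℂ) (n : ℤ) :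
    WeylSumMinusConverges β f (-1 - n) ↔ WeylSumPlusConverges β (fun k => f (-1 - k)) n := by
  simp only [WeylSumMinusConverges, WeylSumPlusConverges]
  refine iff_of_eq ?_
  congr 1; funext i; congr 2; ring

lemma weylDiffMinus_eq_weylConv {α : ℝ} (hα : 0 < α) {f : ℤ → ℂ} {M : ℝ}
    (hM : ∀ n : ℤ, ‖f n‖ ≤ M)
    (hf : ∀ n : ℤ, n < 0 → WeylSumMinusConverges (weylIndex α - α) f n) (n : ℕ) :
    weylDiffMinus α f (-1 - n) = weylConv (kernelSeries (-α)) (fun k : ℕ => f (-1 - k)) n := by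
  rw [weylDiffMinus_eq, weylDiffPlus_eq_weylConv hα (f := fun k => f (-1 - k)) (fun k => hM _)]
  intro k hk
  rw [← weylSumMinusConverges_iff]
  exact hf _ (by omega)

/-! ### Positivity of the coefficients of `((1 - r z) / (1 - z))^α` -/

section RescaledKernel

lemma derivative_rescale (r : ℝ) (φ : PowerSeries ℝ) :
    derivative ℝ (rescale r φ) = C r * rescale r (derivative ℝ φ) := by
  ext n
  simp only [coeff_derivative, coeff_rescale, coeff_C_mul]
  ring

/-- The power series `((1 - r z) / (1 - z))^α`. -/
noncomputable def ratioSeries (α r : ℝ) : PowerSeries ℝ :=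
  kernelSeries α * rescale r (kernelSeries (-α))

lemma ratioSeries_mul (α r β : ℝ) :
    ratioSeries α r * rescale r (kernelSeries β) =
      kernelSeries α * rescale r (kernelSeries (β - α)) := by
  rw [ratioSeries, mul_assoc, ← map_mul, kernelSeries_mul, neg_add_eq_sub]

/-- The logarithmic derivative is `α/(1 - z) - αr/(1 - rz) = α(1 - r)/((1 - z)(1 - rz))`. -/
lemma derivative_ratioSeries (α r : ℝ) :
    (1 - X) * ((1 - C r * X) * derivative ℝ (ratioSeries α r)) =
      C (α * (1 - r)) * ratioSeries α r := by
  have h1 := one_sub_X_mul_derivative_kernelSeries α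
  have h2 := congrArg (rescale r) (one_sub_X_mul_derivative_kernelSeries (-α))
  simp only [map_mul, map_sub, map_one, rescale_X] at h2
  have h3 : rescale r (C (-α)) = C (-α) := by
    ext n; simp only [coeff_rescale, coeff_C]; split_ifs with h <;> simp [h]
  rw [h3] at h2
  rw [ratioSeries, Derivation.leibniz, smul_eq_mul, smul_eq_mul, derivative_rescale]
  simp only [map_mul, map_sub, map_one, map_neg] at h2 ⊢
  linear_combination (1 - C r * X) * rescale r (kernelSeries (-α)) * h1 +
    (1 - X) * C r * kernelSeries α * h2

/-- Let `D` be the coefficients of `(1 - rz)φ'`. The differential equation says that `D` grows by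
`α(1 - r) e(n + 1)`, while `(n + 1) e(n + 1) = D(n) + r n e(n)`; so nonnegativity of `e` and `D`
propagates jointly. -/
lemma coeff_ratioSeries_nonneg {α r : ℝ} (hα : 0 ≤ α) (h0 : 0 ≤ r) (h1 : r ≤ 1) (n : ℕ) :
    0 ≤ coeff n (ratioSeries α r) := by
  set e := fun n => coeff n (ratioSeries α r) with he
  set D := fun n : ℕ => ((n : ℝ) + 1) * e (n + 1) - r * (n * e n) with hD
  have hc : 0 ≤ α * (1 - r) := mul_nonneg hα (by linarith)
  have hDc : ∀ n, coeff n ((1 - C r * X) * derivative ℝ (ratioSeries α r)) = D n := by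
    intro n
    rw [sub_mul, one_mul, map_sub, mul_assoc, coeff_C_mul, coeff_derivative]
    cases n with
    | zero => simp [hD, he]
    | succ n =>
      rw [coeff_succ_X_mul, coeff_derivative]
      simp only [hD, he]
      push_cast; ring
  have hstep : ∀ n, D (n + 1) = D n + α * (1 - r) * e (n + 1) := by
    intro n
    have := congrArg (coeff (n + 1)) (derivative_ratioSeries α r)
    rw [coeff_succ_one_sub_X_mul, hDc, hDc, coeff_C_mul] at this
    linarith
  have hzero : D 0 = α * (1 - r) * e 0 := by
    have := congrArg (coeff 0) (derivative_ratioSeries α r)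
    rwa [sub_mul, one_mul, map_sub, coeff_zero_X_mul, sub_zero, hDc, coeff_C_mul] at this
  have he0 : e 0 = 1 := by simp [he, ratioSeries, coeff_mul]
  have key : ∀ n, 0 ≤ e n ∧ 0 ≤ D n := by
    intro n
    induction n with
    | zero => exact ⟨by rw [he0]; norm_num, by rw [hzero, he0]; linarith⟩
    | succ n ih =>
      have hn : (0 : ℝ) < n + 1 := by positivity
      have hs : 0 ≤ e (n + 1) := by
        have h2 : ((n : ℝ) + 1) * e (n + 1) = D n + r * (n * e n) := by simp only [hD]; ring
        have h3 : 0 ≤ r * (n * e n) := mul_nonneg h0 (mul_nonneg n.cast_nonneg ih.1)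
        exact nonneg_of_mul_nonneg_right (h2 ▸ add_nonneg ih.2 h3) hn
      exact ⟨hs, by rw [hstep]; exact add_nonneg ih.2 (mul_nonneg hc hs)⟩
  exact (key n).1

end RescaledKernel

/-! ### Cesàro sums of `T` and of `rT` -/

section Operator

variable {X : Type*} [NormedAddCommGroup X] [NormedSpace ℂ X]

/-- Real power series as power series with operator coefficients. -/
noncomputable def toOperatorSeries (X : Type*) [NormedAddCommGroup X] [NormedSpace ℂ X] :
    PowerSeries ℝ →+* PowerSeries (X →L[ℂ] X) :=
  PowerSeries.map ((algebraMap ℂ (X →L[ℂ] X)).comp Complex.ofRealHom)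

lemma coeff_toOperatorSeries_mul (φ : PowerSeries ℝ) (u : PowerSeries (X →L[ℂ] X)) (n : ℕ) :
    coeff n (toOperatorSeries X φ * u) =
      ∑ p ∈ antidiagonal n, ((coeff p.1 φ : ℝ) : ℂ) • coeff p.2 u := by
  rw [coeff_mul]
  refine sum_congr rfl fun p _ => ?_
  rw [toOperatorSeries, coeff_map, Algebra.smul_def]
  rfl

lemma cesaroSum_eq_sum_antidiagonal {α : ℝ} (hα : 0 < α) (T : X →L[ℂ] X) (n : ℕ) :
    cesaroSum α T n = ∑ p ∈ antidiagonal n, (genKernel α p.2 : ℂ) • T ^ p.1 := by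
  rw [Nat.sum_antidiagonal_eq_sum_range_succ_mk, cesaroSum]
  simp only [cesaroKernel_eq_genKernel hα]

lemma mk_cesaroSum {α : ℝ} (hα : 0 < α) (T : X →L[ℂ] X) :
    PowerSeries.mk (cesaroSum α T) =
      toOperatorSeries X (kernelSeries α) * PowerSeries.mk (fun n => T ^ n) := by
  ext1 n
  rw [coeff_toOperatorSeries_mul, coeff_mk, cesaroSum_eq_sum_antidiagonal hα,
    ← Nat.sum_antidiagonal_swap]
  simp

lemma mk_smul_cesaroSum {α : ℝ} (hα : 0 < α) (T : X →L[ℂ] X) (r : ℝ) :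
    PowerSeries.mk (fun n => ((r ^ n : ℝ) : ℂ) • cesaroSum α T n) =
      toOperatorSeries X (rescale r (kernelSeries α)) *
        PowerSeries.mk (fun n => ((r : ℂ) • T) ^ n) := by
  ext1 n
  rw [coeff_toOperatorSeries_mul, coeff_mk, cesaroSum_eq_sum_antidiagonal hα,
    ← Nat.sum_antidiagonal_swap, smul_sum]
  refine sum_congr rfl fun p hp => ?_
  rw [← mem_antidiagonal.1 hp, coeff_mk, coeff_rescale, coeff_kernelSeries, smul_pow, smul_smul,
    smul_smul, pow_add]
  push_cast
  simp only [Prod.fst_swap, Prod.snd_swap]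
  congr 1; ring

/-- Both generating series contain `(1 - rzT)^{-1}`, with prefactors `(1 - z)^{-α}` and `(1 -
rz)^{-α}`. -/
lemma mk_cesaroSum_smul {α : ℝ} (hα : 0 < α) (T : X →L[ℂ] X) (r : ℝ) :
    PowerSeries.mk (cesaroSum α ((r : ℂ) • T)) = toOperatorSeries X (ratioSeries α r) *
      PowerSeries.mk (fun n => ((r ^ n : ℝ) : ℂ) • cesaroSum α T n) := by
  rw [mk_cesaroSum hα, mk_smul_cesaroSum hα, ← mul_assoc, ← map_mul, ratioSeries_mul, sub_self,
    kernelSeries_zero, map_one, mul_one]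

lemma IsCesaroBounded.exists_norm_cesaroSum_le {α : ℝ} (hα : 0 < α) {T : X →L[ℂ] X}
    (hT : IsCesaroBounded α T) :
    ∃ K : ℝ, 0 ≤ K ∧ ∀ n, ‖cesaroSum α T n‖ ≤ K * genKernel (α + 1) n := by
  obtain ⟨K, hK⟩ := hT
  refine ⟨K, (norm_nonneg _).trans (hK 0), fun n => ?_⟩
  have hk := genKernel_pos (by linarith : 0 < α + 1) n
  have := hK n
  rw [cesaroMean, cesaroKernel_eq_genKernel (by linarith), norm_smul, norm_div, norm_one,
    Complex.norm_real, Real.norm_of_nonneg hk.le, one_div, inv_mul_le_iff₀ hk] at this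
  linarith

/-- Positivity of the ratio series lets the bound pass with the same `K`: the majorant becomes `K(1
- z)^{-α}(1 - rz)^{-1}`, which is coefficientwise at most `K(1 - z)^{-α-1}`. -/
lemma norm_cesaroSum_smul_le {α : ℝ} (hα : 0 < α) {T : X →L[ℂ] X} {K : ℝ} (hK : 0 ≤ K)
    (h : ∀ n, ‖cesaroSum α T n‖ ≤ K * genKernel (α + 1) n) {r : ℝ} (h0 : 0 ≤ r) (h1 : r ≤ 1)
    (n : ℕ) : ‖cesaroSum α ((r : ℂ) • T) n‖ ≤ K * genKernel (α + 1) n := by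
  have hn := congrArg (coeff n) (mk_cesaroSum_smul hα T r)
  rw [coeff_mk, coeff_toOperatorSeries_mul] at hn
  calc ‖cesaroSum α ((r : ℂ) • T) n‖
      ≤ ∑ p ∈ antidiagonal n, coeff p.1 (ratioSeries α r) *
          (r ^ p.2 * (K * genKernel (α + 1) p.2)) := by
        rw [hn]
        refine norm_sum_le_of_le _ fun p _ => ?_
        rw [norm_smul, Complex.norm_real,
          Real.norm_of_nonneg (coeff_ratioSeries_nonneg hα.le h0 h1 _), coeff_mk, norm_smul,
          Complex.norm_real, Real.norm_of_nonneg (pow_nonneg h0 _)]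
        have := coeff_ratioSeries_nonneg hα.le h0 h1 p.1
        gcongr
        exact h _
    _ = K * coeff n (ratioSeries α r * rescale r (kernelSeries (α + 1))) := by
        rw [coeff_mul, mul_sum]
        refine sum_congr rfl fun p _ => ?_
        rw [coeff_rescale, coeff_kernelSeries]; ring
    _ ≤ K * coeff n (kernelSeries α * kernelSeries 1) := by
        rw [ratioSeries_mul, add_sub_cancel_left, coeff_mul, coeff_mul]
        refine mul_le_mul_of_nonneg_left (sum_le_sum fun p _ => ?_) hK
        rw [coeff_rescale, coeff_kernelSeries, coeff_kernelSeries]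
        refine mul_le_mul_of_nonneg_left ?_ (genKernel_pos hα _).le
        exact mul_le_of_le_one_left (genKernel_pos one_pos _).le (pow_le_one₀ h0 h1)
    _ = K * genKernel (α + 1) n := by rw [kernelSeries_mul, coeff_kernelSeries]

/-- The powers are recovered from the Cesàro sums through `(1 - z)^α`, whose coefficients are
absolutely summable. This growth bound makes the Neumann series of `rT` converge for `0 < r < 1`. -/
lemma exists_norm_pow_le {α : ℝ} (hα : 0 < α) {T : X →L[ℂ] X} {K : ℝ} (hK : 0 ≤ K)
    (h : ∀ n, ‖cesaroSum α T n‖ ≤ K * genKernel (α + 1) n) :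
    ∃ B : ℝ, ∀ n, ‖T ^ n‖ ≤ B * genKernel (α + 1) n := by
  have hs := summable_norm_genKernel_neg hα.le
  refine ⟨(∑' i, ‖genKernel (-α) i‖) * K, fun n => ?_⟩
  have hn : T ^ n = coeff n (toOperatorSeries X (kernelSeries (-α)) *
      PowerSeries.mk (cesaroSum α T)) := by
    rw [mk_cesaroSum hα, ← mul_assoc, ← map_mul, kernelSeries_mul, neg_add_cancel,
      kernelSeries_zero, map_one, one_mul, coeff_mk]
  rw [coeff_toOperatorSeries_mul] at hn
  calc ‖T ^ n‖ ≤ ∑ p ∈ antidiagonal n, ‖genKernel (-α) p.1‖ * (K * genKernel (α + 1) n) := by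
        rw [hn]
        refine norm_sum_le_of_le _ fun p hp => ?_
        rw [norm_smul, Complex.norm_real, coeff_kernelSeries, coeff_mk]
        gcongr
        refine (h _).trans (mul_le_mul_of_nonneg_left (monotone_genKernel_add_one hα ?_) hK)
        have := mem_antidiagonal.1 hp; omega
    _ = (∑ i ∈ range (n + 1), ‖genKernel (-α) i‖) * (K * genKernel (α + 1) n) := by
        rw [Nat.sum_antidiagonal_eq_sum_range_succ_mk, sum_mul]
    _ ≤ (∑' i, ‖genKernel (-α) i‖) * (K * genKernel (α + 1) n) := by
        have := genKernel_pos (by linarith : 0 < α + 1) n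
        gcongr
        exact hs.sum_le_tsum _ fun _ _ => norm_nonneg _
    _ = _ := by ring

lemma summable_pow_mul_norm_pow {α : ℝ} (hα : 0 < α) {T : X →L[ℂ] X}
    (hT : IsCesaroBounded α T) {r : ℝ} (h0 : 0 < r) (h1 : r < 1) :
    Summable fun n => r ^ n * ‖T ^ n‖ := by
  obtain ⟨K, hK, h⟩ := hT.exists_norm_cesaroSum_le hα
  obtain ⟨B, hB⟩ := exists_norm_pow_le hα hK h
  refine Summable.of_nonneg_of_le (fun n => mul_nonneg (pow_nonneg h0.le _) (norm_nonneg _))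
    (fun n => ?_) ((summable_mul_pow_genKernel (by linarith : 0 < α + 1) h0 h1).mul_left B)
  calc r ^ n * ‖T ^ n‖ ≤ r ^ n * (B * genKernel (α + 1) n) :=
        mul_le_mul_of_nonneg_left (hB n) (pow_nonneg h0.le _)
    _ = _ := by ring

end Operator

/-- Vector-valued Riemann–Lebesgue: the coefficients are values, at the frequencies `n / L`, of the
Fourier transform on `ℝ` of one period cut off by zero. Non-integrable functions are covered because
their integrals are zero by convention. -/
lemma tendsto_fourierCoeff_cofinite {E : Type*} [NormedAddCommGroup E] [NormedSpace ℂ E]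
    {L : ℝ} [hL : Fact (0 < L)] (f : AddCircle L → E) :
    Tendsto (fourierCoeff f) cofinite (𝓝 0) := by
  have hL0 := hL.out
  have h1 := Real.tendsto_integral_exp_smul_cocompact
    ((Set.Ioc 0 L).indicator fun x : ℝ => f (x : AddCircle L))
  have h2 : Tendsto (fun n : ℤ => L⁻¹ * (n : ℝ)) cofinite (cocompact ℝ) :=
    (Homeomorph.mulLeft₀ L⁻¹ (inv_ne_zero hL0.ne')).isClosedEmbedding.tendsto_cocompact.comp
      Int.tendsto_coe_cofinite
  have h3 := (h1.comp h2).const_smul (1 / L)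
  rw [smul_zero] at h3
  refine h3.congr fun n => ?_
  rw [fourierCoeff_eq_intervalIntegral f n 0, zero_add, intervalIntegral.integral_of_le hL0.le,
    ← MeasureTheory.integral_indicator measurableSet_Ioc]
  simp only [Function.comp]
  congr 2
  funext v
  by_cases hv : v ∈ Set.Ioc 0 L
  · rw [Set.indicator_of_mem hv, Set.indicator_of_mem hv, fourier_coe_apply, Circle.smul_def,
      Real.fourierChar_apply]
    congr 2
    push_cast
    field_simp
  · simp [Set.indicator_of_notMem hv]

/-! ### Abel summation of the functional calculus -/

section Abel

variable {X : Type*} [NormedAddCommGroup X] [NormedSpace ℂ X] [CompleteSpace X]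

/-- For `r < 1` the double series over `(l, i)` converges absolutely; collecting the terms with `l +
i = j` leaves `b_j` times the Cesàro sum of `rT`. -/
lemma tsum_weylConv_smul_pow {α : ℝ} (hα : 0 < α) {T : X →L[ℂ] X} (hT : IsCesaroBounded α T)
    {b : ℕ → ℂ} (hb : Summable fun j => ‖b j‖ * genKernel (α + 1) j) {r : ℝ} (h0 : 0 < r)
    (h1 : r < 1) :
    ∑' l, (weylConv (kernelSeries α) b l * (r : ℂ) ^ l) • T ^ l =
      ∑' j, b j • cesaroSum α ((r : ℂ) • T) j := by
  set F : ℕ × ℕ → X →L[ℂ] X := fun p =>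
    ((coeff p.2 (kernelSeries α) : ℝ) * b (p.1 + p.2) * (r : ℂ) ^ p.1 : ℂ) • T ^ p.1 with hF
  have hFs : Summable F := by
    refine Summable.of_norm_bounded (summable_mul_shift
      (summable_pow_mul_norm_pow hα hT h0 h1).norm hb.norm 0) fun p => ?_
    have := norm_genKernel_mul_le hα b p.1 p.2
    rw [hF]
    simp only [zero_add]
    rw [norm_smul, norm_mul, norm_mul, Complex.norm_real, norm_pow, Complex.norm_real,
      Real.norm_of_nonneg h0.le, coeff_kernelSeries, Real.norm_of_nonneg (genKernel_pos hα _).le]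
    calc _ = r ^ p.1 * ‖T ^ p.1‖ * (genKernel α p.2 * ‖b (p.1 + p.2)‖) := by ring
      _ ≤ _ := by gcongr
  have hs : ∀ l, Summable fun i => ((coeff i (kernelSeries α) : ℝ) : ℂ) * b (l + i) := by
    intro l
    refine Summable.of_norm_bounded (((summable_nat_add_iff l).2 hb)) fun i => ?_
    rw [norm_mul, Complex.norm_real, coeff_kernelSeries, Real.norm_of_nonneg
      (genKernel_pos hα _).le, add_comm i l]
    exact norm_genKernel_mul_le hα b l i
  trans ∑' l, ∑' i, F (l, i)
  · refine tsum_congr fun l => ?_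
    rw [weylConv, ← tsum_mul_right, ← (((hs l).mul_right _)).tsum_smul_const]
  · rw [tsum_tsum_eq_tsum_sum_antidiagonal hFs]
    refine tsum_congr fun j => ?_
    rw [cesaroSum_eq_sum_antidiagonal hα, smul_sum]
    refine sum_congr rfl fun p hp => ?_
    rw [hF, ← mem_antidiagonal.1 hp]
    simp only [coeff_kernelSeries]
    rw [smul_pow, smul_smul, smul_smul]
    congr 1; ring

/-- Abel summation of `∑ a_l T^l` for `a = W_+^{-α} b` reproduces the functional calculus. -/
lemma tendsto_tsum_weylConv_smul_pow {α : ℝ} (hα : 0 < α) {T : X →L[ℂ] X}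
    (hT : IsCesaroBounded α T) {b : ℕ → ℂ}
    (hb : Summable fun j => ‖b j‖ * genKernel (α + 1) j) {ρ : ℕ → ℝ} (h0 : ∀ N, 0 < ρ N)
    (h1 : ∀ N, ρ N < 1) (hρ : Tendsto ρ atTop (𝓝 1)) :
    Tendsto (fun N => ∑' l, (weylConv (kernelSeries α) b l * (ρ N : ℂ) ^ l) • T ^ l) atTop
      (𝓝 (∑' j, b j • cesaroSum α T j)) := by
  obtain ⟨K, hK, h⟩ := hT.exists_norm_cesaroSum_le hα
  simp only [fun N => tsum_weylConv_smul_pow hα hT hb (h0 N) (h1 N)]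
  refine tendsto_tsum_of_dominated_convergence (hb.mul_left K) (fun j => ?_)
    (.of_forall fun N j => ?_)
  · refine Tendsto.const_smul ?_ _
    have hc : Continuous fun r : ℝ => cesaroSum α ((r : ℂ) • T) j := by
      unfold cesaroSum
      fun_prop
    have := (hc.tendsto 1).comp hρ
    simp only [Complex.ofReal_one, one_smul] at this
    exact this
  · rw [norm_smul]
    calc _ ≤ ‖b j‖ * (K * genKernel (α + 1) j) := by
          gcongr
          exact norm_cesaroSum_smul_le hα hK h (h0 N).le (h1 N).le j
      _ = _ := by ring

end Abel

/-! ### The resolvent on the unit circle -/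

section Resolvent

variable {X : Type*} [NormedAddCommGroup X] [NormedSpace ℂ X]

/-- The function `g(t) (1 - r e^{-it} T)^{-1}`. -/
noncomputable def resolventMul (T : X →L[ℂ] X) (g : C(AddCircle (2 * Real.pi), ℂ)) (r : ℝ)
    (t : AddCircle (2 * Real.pi)) : X →L[ℂ] X :=
  g t • Ring.inverse (1 - ((r : ℂ) * fourier (-1) t) • T)

lemma isUnit_one_sub_of_notMem {T : X →L[ℂ] X} {t : AddCircle (2 * Real.pi)}
    (ht : t ∉ unitarySpectrum T) : IsUnit (1 - (fourier (-1) t : ℂ) • T) := by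
  have h : IsUnit (algebraMap ℂ (X →L[ℂ] X) (fourier 1 t) - T) := by
    rw [fourier_one]
    exact spectrum.notMem_iff.1 ht
  have hu : (fourier (-1) t : ℂ) * fourier 1 t = 1 := by
    rw [← fourier_add]; simp
  have hne : (fourier (-1) t : ℂ) ≠ 0 := left_ne_zero_of_mul_eq_one hu
  have : 1 - (fourier (-1) t : ℂ) • T =
      Units.mk0 _ hne • (algebraMap ℂ (X →L[ℂ] X) (fourier 1 t) - T) := by
    rw [Units.smul_mk0, smul_sub, Algebra.algebraMap_eq_smul_one, smul_smul, hu, one_smul]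
  rw [this]
  exact h.smul _

variable [CompleteSpace X]

lemma summable_norm_smul_pow {α : ℝ} (hα : 0 < α) {T : X →L[ℂ] X} (hT : IsCesaroBounded α T)
    {r : ℝ} (h0 : 0 < r) (h1 : r < 1) (t : AddCircle (2 * Real.pi)) :
    Summable fun l => (((r : ℂ) * fourier (-1) t) • T) ^ l := by
  refine Summable.of_norm_bounded (summable_pow_mul_norm_pow hα hT h0 h1) fun l => ?_
  rw [smul_pow, norm_smul, norm_pow, norm_mul, Complex.norm_real, Real.norm_of_nonneg h0.le,
    fourier_apply, Circle.norm_coe, mul_one]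

lemma inverse_one_sub_eq_tsum {α : ℝ} (hα : 0 < α) {T : X →L[ℂ] X} (hT : IsCesaroBounded α T)
    {r : ℝ} (h0 : 0 < r) (h1 : r < 1) (t : AddCircle (2 * Real.pi)) :
    IsUnit (1 - ((r : ℂ) * fourier (-1) t) • T) ∧
      Ring.inverse (1 - ((r : ℂ) * fourier (-1) t) • T) =
        ∑' l, (((r : ℂ) * fourier (-1) t) • T) ^ l := by
  have hs := summable_norm_smul_pow hα hT h0 h1 t
  let u : (X →L[ℂ] X)ˣ := ⟨1 - ((r : ℂ) * fourier (-1) t) • T, _, hs.one_sub_mul_tsum_pow,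
    hs.tsum_pow_mul_one_sub⟩
  exact ⟨u.isUnit, Ring.inverse_unit u⟩

/-- Near a point of the unitary spectrum `g` vanishes for every `r`, which hides the value 0 that
`Ring.inverse` takes at non-units. Elsewhere `1 - re^{-it}T` is invertible, by the Neumann series if
`r < 1` and by the choice of `t` if `r = 1`, and inversion is continuous. The endpoint `1/2` only
keeps `r` positive. -/
lemma continuous_resolventMul {α : ℝ} (hα : 0 < α) {T : X →L[ℂ] X} (hT : IsCesaroBounded α T)
    {g : C(AddCircle (2 * Real.pi), ℂ)} (hg : ∀ᶠ t in 𝓝ˢ (unitarySpectrum T), g t = 0) :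
    Continuous (Function.uncurry fun (r : Set.Icc (1 / 2 : ℝ) 1) t => resolventMul T g r t) := by
  rw [continuous_iff_continuousAt]
  rintro ⟨⟨r, hr⟩, t⟩
  by_cases ht : t ∈ unitarySpectrum T
  · have h0 : ∀ᶠ s in 𝓝 t, g s = 0 := eventually_nhdsSet_iff_forall.1 hg t ht
    have h1 : ∀ᶠ p : Set.Icc (1 / 2 : ℝ) 1 × AddCircle (2 * Real.pi) in 𝓝 (⟨r, hr⟩, t),
        g p.2 = 0 := by
      have hs : Tendsto (fun p : Set.Icc (1 / 2 : ℝ) 1 × AddCircle (2 * Real.pi) => p.2)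
        (𝓝 (⟨r, hr⟩, t)) (𝓝 t) := continuous_snd.tendsto _
      exact hs.eventually h0
    refine (continuousAt_const (y := (0 : X →L[ℂ] X))).congr ?_
    filter_upwards [h1] with p hp
    simp [Function.uncurry, resolventMul, hp]
  · have hu : IsUnit (1 - ((r : ℂ) * fourier (-1) t) • T) := by
      rcases hr.2.lt_or_eq with h | h
      · exact (inverse_one_sub_eq_tsum hα hT (by linarith [hr.1]) h t).1
      · rw [h, Complex.ofReal_one, one_mul]; exact isUnit_one_sub_of_notMem ht
    obtain ⟨u, hu⟩ := hu
    have hinv := NormedRing.inverse_continuousAt u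
    rw [hu] at hinv
    have h1 : ContinuousAt (fun p : Set.Icc (1 / 2 : ℝ) 1 × AddCircle (2 * Real.pi) =>
        1 - (((p.1 : ℝ) : ℂ) * fourier (-1) p.2) • T) (⟨r, hr⟩, t) := by fun_prop
    have h2 : ContinuousAt (fun p : Set.Icc (1 / 2 : ℝ) 1 × AddCircle (2 * Real.pi) => g p.2)
        (⟨r, hr⟩, t) := by fun_prop
    exact h2.smul (hinv.comp_of_eq h1 rfl)

/-- Expand the Neumann series and integrate termwise; only the coefficients of `g` with nonnegative
index appear. -/
lemma integral_resolventMul {α : ℝ} (hα : 0 < α) {T : X →L[ℂ] X} (hT : IsCesaroBounded α T)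
    (g : C(AddCircle (2 * Real.pi), ℂ)) {r : ℝ} (h0 : 0 < r) (h1 : r < 1) :
    ∫ t, resolventMul T g r t ∂AddCircle.haarAddCircle =
      ∑' l : ℕ, (coeffs g l * (r : ℂ) ^ l) • T ^ l := by
  have hpt : ∀ t, resolventMul T g r t =
      ∑' l : ℕ, (fourier (-(l : ℤ)) t * g t * (r : ℂ) ^ l) • T ^ l := by
    intro t
    rw [resolventMul, (inverse_one_sub_eq_tsum hα hT h0 h1 t).2,
      ← (summable_norm_smul_pow hα hT h0 h1 t).tsum_const_smul]
    refine tsum_congr fun l => ?_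
    rw [smul_pow, smul_smul]
    congr 1
    have : (fourier (-1) t : ℂ) ^ l = fourier (-(l : ℤ)) t := by
      rw [fourier_apply, fourier_apply, ← Circle.coe_pow, ← AddCircle.toCircle_nsmul]
      simp
    rw [mul_pow, this]; ring
  have hcont : ∀ l : ℕ, Continuous fun t : AddCircle (2 * Real.pi) =>
      (fourier (-(l : ℤ)) t * g t * (r : ℂ) ^ l) • T ^ l := fun l => by fun_prop
  have hsum := MeasureTheory.hasSum_integral_of_summable_integral_norm
    (μ := AddCircle.haarAddCircle)
    (F := fun (l : ℕ) (t : AddCircle (2 * Real.pi)) =>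
      (fourier (-(l : ℤ)) t * g t * (r : ℂ) ^ l) • T ^ l)
    (fun l => (hcont l).integrable_of_hasCompactSupport (HasCompactSupport.of_compactSpace _)) ?_
  · simp only [hpt]
    rw [← hsum.tsum_eq]
    refine tsum_congr fun l => ?_
    rw [integral_smul_const, MeasureTheory.integral_mul_const]
    rfl
  · refine Summable.of_nonneg_of_le (fun l => MeasureTheory.integral_nonneg fun _ => norm_nonneg _)
      (fun l => ?_) ((summable_pow_mul_norm_pow hα hT h0 h1).mul_left ‖g‖)
    have hb : ∀ t : AddCircle (2 * Real.pi),
        ‖(fourier (-(l : ℤ)) t * g t * (r : ℂ) ^ l) • T ^ l‖ ≤ ‖g‖ * (r ^ l * ‖T ^ l‖) := by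
      intro t
      rw [norm_smul, norm_mul, norm_mul, norm_pow, Complex.norm_real, Real.norm_of_nonneg h0.le,
        fourier_apply, Circle.norm_coe, one_mul, mul_assoc]
      gcongr
      exact g.norm_coe_le_norm t
    calc _ ≤ ∫ _t : AddCircle (2 * Real.pi), ‖g‖ * (r ^ l * ‖T ^ l‖) ∂AddCircle.haarAddCircle :=
          MeasureTheory.integral_mono_of_nonneg (.of_forall fun _ => norm_nonneg _)
            (MeasureTheory.integrable_const _) (.of_forall hb)
      _ = _ := by simp

lemma tendsto_integral_resolventMul {α : ℝ} (hα : 0 < α) {T : X →L[ℂ] X}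
    (hT : IsCesaroBounded α T) {g : C(AddCircle (2 * Real.pi), ℂ)}
    (hg : ∀ᶠ t in 𝓝ˢ (unitarySpectrum T), g t = 0) {ρ : ℕ → ℝ} (h0 : ∀ N, 1 / 2 ≤ ρ N)
    (h1 : ∀ N, ρ N ≤ 1) (hρ : Tendsto ρ atTop (𝓝 1)) :
    Tendsto (fun N => ∫ t, resolventMul T g (ρ N) t ∂AddCircle.haarAddCircle) atTop
      (𝓝 (∫ t, resolventMul T g 1 t ∂AddCircle.haarAddCircle)) := by
  have hc : Continuous fun r : Set.Icc (1 / 2 : ℝ) 1 =>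
      ∫ t, resolventMul T g r t ∂AddCircle.haarAddCircle := by
    have := continuous_parametric_integral_of_continuous (μ := AddCircle.haarAddCircle)
      (continuous_resolventMul hα hT hg) isCompact_univ
    rwa [MeasureTheory.Measure.restrict_univ] at this
  have hone : (1 : ℝ) ∈ Set.Icc (1 / 2 : ℝ) 1 := by norm_num
  have hρ' : Tendsto (fun N => (⟨ρ N, h0 N, h1 N⟩ : Set.Icc (1 / 2 : ℝ) 1)) atTop
      (𝓝 ⟨1, hone⟩) := tendsto_subtype_rng.2 hρ
  have := (hc.tendsto ⟨1, hone⟩).comp hρ'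
  exact this

lemma continuous_resolventMul_one {α : ℝ} (hα : 0 < α) {T : X →L[ℂ] X}
    (hT : IsCesaroBounded α T) {g : C(AddCircle (2 * Real.pi), ℂ)}
    (hg : ∀ᶠ t in 𝓝ˢ (unitarySpectrum T), g t = 0) : Continuous (resolventMul T g 1) := by
  have hone : (1 : ℝ) ∈ Set.Icc (1 / 2 : ℝ) 1 := by norm_num
  exact (continuous_resolventMul hα hT hg).comp
    ((continuous_const (y := (⟨1, hone⟩ : Set.Icc (1 / 2 : ℝ) 1))).prodMk continuous_id)

/-- Multiply `G = g + e^{-it} T G` by `e^{i(j+1)t}` and integrate; on the unitary spectrum `g`,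
hence `G`, is zero. -/
lemma fourierCoeff_resolventMul_succ {α : ℝ} (hα : 0 < α) {T : X →L[ℂ] X}
    (hT : IsCesaroBounded α T) {g : C(AddCircle (2 * Real.pi), ℂ)}
    (hg : ∀ᶠ t in 𝓝ˢ (unitarySpectrum T), g t = 0) (j : ℕ) :
    fourierCoeff (resolventMul T g 1) (-((j + 1 : ℕ) : ℤ)) =
      coeffs g (-((j + 1 : ℕ) : ℤ)) • (1 : X →L[ℂ] X) +
        T * fourierCoeff (resolventMul T g 1) (-(j : ℤ)) := by
  have hG := continuous_resolventMul_one hα hT hg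
  have hpt : ∀ t, (fourier (- -((j + 1 : ℕ) : ℤ)) t : ℂ) • resolventMul T g 1 t =
      ((fourier (- -((j + 1 : ℕ) : ℤ)) t : ℂ) • g t) • (1 : X →L[ℂ] X) +
        T * ((fourier (- -(j : ℤ)) t : ℂ) • resolventMul T g 1 t) := by
    intro t
    by_cases ht : t ∈ unitarySpectrum T
    · have h0 : g t = 0 := (eventually_nhdsSet_iff_forall.1 hg t ht).self_of_nhds
      simp [resolventMul, h0]
    · have h1 := Ring.mul_inverse_cancel _ (isUnit_one_sub_of_notMem ht)
      rw [sub_mul, one_mul, sub_eq_iff_eq_add, smul_mul_assoc] at h1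
      have h2 : resolventMul T g 1 t =
          g t • (1 : X →L[ℂ] X) + (fourier (-1) t : ℂ) • (T * resolventMul T g 1 t) := by
        simp only [resolventMul, Complex.ofReal_one, one_mul]
        conv_lhs => rw [h1]
        rw [smul_add, mul_smul_comm, smul_comm]
      have h3 : (fourier (- -((j + 1 : ℕ) : ℤ)) t : ℂ) * fourier (-1) t =
          fourier (- -(j : ℤ)) t := by
        rw [← fourier_add]; congr 1; push_cast; ring_nf
      conv_lhs => rw [h2]
      rw [smul_add, smul_smul, smul_smul, h3, mul_smul_comm, smul_eq_mul]
  have hi : ∀ n : ℤ, MeasureTheory.Integrable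
      (fun t => (fourier n t : ℂ) • resolventMul T g 1 t) AddCircle.haarAddCircle := fun n =>
    (by fun_prop : Continuous fun t => (fourier n t : ℂ) • resolventMul T g 1 t)
      |>.integrable_of_hasCompactSupport (HasCompactSupport.of_compactSpace _)
  have hi' : ∀ n : ℤ, MeasureTheory.Integrable
      (fun t => ((fourier n t : ℂ) • g t) • (1 : X →L[ℂ] X)) AddCircle.haarAddCircle := fun n =>
    (by fun_prop : Continuous fun t => ((fourier n t : ℂ) • g t) • (1 : X →L[ℂ] X))
      |>.integrable_of_hasCompactSupport (HasCompactSupport.of_compactSpace _)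
  rw [fourierCoeff]
  simp only [hpt]
  rw [MeasureTheory.integral_add (hi' _) ((hi _).const_mul T), integral_smul_const]
  exact congrArg _ (ContinuousLinearMap.integral_comp_comm
    (ContinuousLinearMap.mul ℂ (X →L[ℂ] X) T) (hi (- -(j : ℤ))))

/-- The functional calculus as an integral of the resolvent on the unit circle. -/
lemma fourierCoeff_resolventMul_zero {α : ℝ} (hα : 0 < α) {T : X →L[ℂ] X}
    (hT : IsCesaroBounded α T) {g : C(AddCircle (2 * Real.pi), ℂ)}
    (hg : ∀ᶠ t in 𝓝ˢ (unitarySpectrum T), g t = 0) {b : ℕ → ℂ}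
    (hb : Summable fun j => ‖b j‖ * genKernel (α + 1) j)
    (hgb : ∀ l : ℕ, weylConv (kernelSeries α) b l = coeffs g l) :
    fourierCoeff (resolventMul T g 1) 0 = ∑' j, b j • cesaroSum α T j := by
  -- Radii in `[1/2, 1)` tending to 1, along which the integral and the Abel sums are the same
  -- sequence; its two computed limits must agree.
  set ρ : ℕ → ℝ := fun N => 1 - 1 / 2 * (1 / ((N : ℝ) + 1)) with hρdef
  have hpos : ∀ N : ℕ, 0 < 1 / ((N : ℝ) + 1) := fun N => by positivity
  have hle : ∀ N : ℕ, 1 / ((N : ℝ) + 1) ≤ 1 := fun N => by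
    rw [div_le_one (by positivity)]; linarith [(Nat.cast_nonneg N : (0 : ℝ) ≤ N)]
  have h0 : ∀ N, 1 / 2 ≤ ρ N := fun N => by simp only [hρdef]; linarith [hle N]
  have h1 : ∀ N, ρ N < 1 := fun N => by simp only [hρdef]; linarith [hpos N]
  have hρ : Tendsto ρ atTop (𝓝 1) := by
    have := ((tendsto_one_div_add_atTop_nhds_zero_nat (𝕜 := ℝ)).const_mul (1 / 2)).const_sub 1
    simpa only [hρdef, mul_zero, sub_zero] using this
  have hA := tendsto_tsum_weylConv_smul_pow hα hT hb (fun N => by linarith [h0 N]) h1 hρ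
  have hB := tendsto_integral_resolventMul hα hT hg h0 (fun N => (h1 N).le) hρ
  have hC : fourierCoeff (resolventMul T g 1) 0 =
      ∫ t, resolventMul T g 1 t ∂AddCircle.haarAddCircle := by simp [fourierCoeff]
  rw [hC]
  refine tendsto_nhds_unique hB (hA.congr fun N => ?_)
  rw [integral_resolventMul hα hT g (by linarith [h0 N]) (h1 N)]
  simp only [hgb]

end Resolvent

/-! ### The algebras `A^α(𝕋)` -/

section Wiener

variable {α : ℝ} {f g : C(AddCircle (2 * Real.pi), ℂ)}

lemma coeffs_sub : coeffs (f - g) = fun n => coeffs f n - coeffs g n := by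
  have hi : ∀ (h : C(AddCircle (2 * Real.pi), ℂ)) (n : ℤ), MeasureTheory.Integrable
      (fun t => (fourier n t : ℂ) • h t) AddCircle.haarAddCircle := fun h n =>
    (by fun_prop : Continuous fun t => (fourier n t : ℂ) • h t)
      |>.integrable_of_hasCompactSupport (HasCompactSupport.of_compactSpace _)
  funext n
  simp only [coeffs, fourierCoeff]
  rw [← MeasureTheory.integral_sub (hi f _) (hi g _)]
  simp only [ContinuousMap.sub_apply, smul_sub]

lemma exists_norm_coeffs_le (f : C(AddCircle (2 * Real.pi), ℂ)) :
    ∃ M, ∀ n, ‖coeffs f n‖ ≤ M := by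
  refine ⟨‖f‖, fun n => ?_⟩
  refine (MeasureTheory.norm_integral_le_of_norm_le_const (C := ‖f‖) (.of_forall fun t => ?_)).trans
    (by simp)
  rw [norm_smul, fourier_apply, Circle.norm_coe, one_mul]
  exact f.norm_coe_le_norm t

lemma weylDiff_sub {u v : ℤ → ℂ} (hu : WeylDiffConverges α u) (hv : WeylDiffConverges α v)
    (n : ℤ) : weylDiff α (fun k => u k - v k) n = weylDiff α u n - weylDiff α v n := by
  unfold weylDiff
  split_ifs with hn
  · rw [weylDiffPlus, weylDiffPlus, weylDiffPlus, natDiffPlus, natDiffPlus, natDiffPlus,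
      ← sum_sub_distrib]
    refine sum_congr rfl fun j _ => ?_
    rw [weylSumPlus, weylSumPlus, weylSumPlus, ← mul_sub,
      ← (hu.1 (n + j) (by omega)).tsum_sub (hv.1 (n + j) (by omega))]
    simp only [mul_sub]
  · rw [weylDiffMinus, weylDiffMinus, weylDiffMinus, natDiffMinus, natDiffMinus, natDiffMinus,
      ← sum_sub_distrib]
    refine sum_congr rfl fun j _ => ?_
    rw [weylSumMinus, weylSumMinus, weylSumMinus, ← mul_sub,
      ← (hu.2 (n - j) (by omega)).tsum_sub (hv.2 (n - j) (by omega))]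
    simp only [mul_sub]

lemma cesaroKernel_add_one_nonneg (hα : 0 < α) (n : ℕ) : 0 ≤ cesaroKernel (α + 1) n := by
  rw [cesaroKernel_eq_genKernel (by linarith)]
  exact (genKernel_pos (by linarith) n).le

lemma MemWiener.sub (hα : 0 < α) (hf : MemWiener α f) (hg : MemWiener α g) :
    MemWiener α (f - g) := by
  refine ⟨⟨fun n hn => ?_, fun n hn => ?_⟩, ?_⟩
  · have := (hf.1.1 n hn).sub (hg.1.1 n hn)
    rw [coeffs_sub, WeylSumPlusConverges]
    simpa only [mul_sub] using this
  · have := (hf.1.2 n hn).sub (hg.1.2 n hn)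
    rw [coeffs_sub, WeylSumMinusConverges]
    simpa only [mul_sub] using this
  · refine Summable.of_nonneg_of_le
      (fun n => mul_nonneg (norm_nonneg _) (cesaroKernel_add_one_nonneg hα _)) (fun n => ?_)
      (hf.2.add hg.2)
    rw [coeffs_sub, weylDiff_sub hf.1 hg.1, ← add_mul]
    exact mul_le_mul_of_nonneg_right (norm_sub_le _ _) (cesaroKernel_add_one_nonneg hα _)

lemma weylDiffPlus_sub (hf : MemWiener α f) (hg : MemWiener α g) (n : ℕ) :
    weylDiffPlus α (coeffs (f - g)) n =
      weylDiffPlus α (coeffs f) n - weylDiffPlus α (coeffs g) n := by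
  have := weylDiff_sub hf.1 hg.1 n
  simpa only [coeffs_sub, weylDiff, Int.natCast_nonneg, if_true] using this

lemma MemWiener.summable_plus (hα : 0 < α) (hf : MemWiener α f) :
    Summable (fun n : ℕ => ‖weylDiffPlus α (coeffs f) n‖ * genKernel (α + 1) n) ∧
      ∑' n : ℕ, ‖weylDiffPlus α (coeffs f) n‖ * genKernel (α + 1) n ≤ wienerNorm α f := by
  have hinj : Function.Injective fun n : ℕ => (n : ℤ) := Nat.cast_injective
  have heq : (fun n : ℕ => ‖weylDiffPlus α (coeffs f) n‖ * genKernel (α + 1) n) =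
      (fun n : ℤ => ‖weylDiff α (coeffs f) n‖ * cesaroKernel (α + 1) n.natAbs) ∘
        fun n : ℕ => (n : ℤ) := by
    funext n
    simp [weylDiff, cesaroKernel_eq_genKernel (by linarith : 0 < α + 1)]
  rw [heq]
  exact ⟨hf.2.comp_injective hinj, tsum_comp_le_tsum_of_inj hf.2
    (fun n => mul_nonneg (norm_nonneg _) (cesaroKernel_add_one_nonneg hα _)) hinj⟩

lemma MemWiener.summable_minus (hα : 0 < α) (hf : MemWiener α f) :
    Summable (fun n : ℕ => ‖weylDiffMinus α (coeffs f) (-1 - n)‖ * genKernel (α + 1) n) ∧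
      ∑' n : ℕ, ‖weylDiffMinus α (coeffs f) (-1 - n)‖ * genKernel (α + 1) n ≤
        wienerNorm α f := by
  have hinj : Function.Injective fun n : ℕ => -1 - (n : ℤ) := fun a b h => by
    simp only at h; omega
  -- The weight at `-1 - n` is `k^{α+1}(n + 1)`; monotonicity lowers it to `k^{α+1}(n)`, matching
  -- the reflected sequence.
  have hle : ∀ n : ℕ, ‖weylDiffMinus α (coeffs f) (-1 - n)‖ * genKernel (α + 1) n ≤
      ((fun n : ℤ => ‖weylDiff α (coeffs f) n‖ * cesaroKernel (α + 1) n.natAbs) ∘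
        fun n : ℕ => -1 - (n : ℤ)) n := by
    intro n
    have h1 : ¬ (0 : ℤ) ≤ -1 - n := by omega
    have h2 : (-1 - (n : ℤ)).natAbs = n + 1 := by omega
    simp only [Function.comp, weylDiff, if_neg h1, h2,
      cesaroKernel_eq_genKernel (by linarith : 0 < α + 1)]
    exact mul_le_mul_of_nonneg_left (monotone_genKernel_add_one hα n.le_succ) (norm_nonneg _)
  have hs := hf.2.comp_injective hinj
  have hs' := Summable.of_nonneg_of_le (fun n => mul_nonneg (norm_nonneg _)
    (genKernel_pos (by linarith : 0 < α + 1) n).le) hle hs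
  exact ⟨hs', (hs'.tsum_le_tsum hle hs).trans (tsum_comp_le_tsum_of_inj hf.2
    (fun n => mul_nonneg (norm_nonneg _) (cesaroKernel_add_one_nonneg hα _)) hinj)⟩

lemma tendsto_coeffs_natCast (f : C(AddCircle (2 * Real.pi), ℂ)) :
    Tendsto (fun n : ℕ => coeffs f n) atTop (𝓝 0) := by
  rw [← Nat.cofinite_eq_atTop]
  exact (tendsto_fourierCoeff_cofinite f).comp Nat.cast_injective.tendsto_cofinite

lemma tendsto_coeffs_neg_one_sub (f : C(AddCircle (2 * Real.pi), ℂ)) :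
    Tendsto (fun n : ℕ => coeffs f (-1 - n)) atTop (𝓝 0) := by
  have hinj : Function.Injective fun n : ℕ => -1 - (n : ℤ) := fun a b h => by
    simp only at h; omega
  rw [← Nat.cofinite_eq_atTop]
  exact (tendsto_fourierCoeff_cofinite f).comp hinj.tendsto_cofinite

/-- Fourier coefficients form a null sequence, so the inversion theorem applies. -/
lemma MemWiener.weylConv_plus (hα : 0 < α) (hf : MemWiener α f) (l : ℕ) :
    weylConv (kernelSeries α) (fun n => weylDiffPlus α (coeffs f) n) l = coeffs f l := by
  obtain ⟨M, hM⟩ := exists_norm_coeffs_le f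
  have h := fun n : ℕ => weylDiffPlus_eq_weylConv hα (fun n : ℕ => hM n) hf.1.1 n
  have hs := (hf.summable_plus hα).1
  simp only [h] at hs ⊢
  exact weylConv_kernelSeries_inversion hα (tendsto_coeffs_natCast f) hs l

lemma MemWiener.weylConv_minus (hα : 0 < α) (hf : MemWiener α f) (l : ℕ) :
    weylConv (kernelSeries α) (fun n => weylDiffMinus α (coeffs f) (-1 - n)) l =
      coeffs f (-1 - l) := by
  obtain ⟨M, hM⟩ := exists_norm_coeffs_le f
  have h := fun n : ℕ => weylDiffMinus_eq_weylConv hα hM hf.1.2 n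
  have hs := (hf.summable_minus hα).1
  simp only [h] at hs ⊢
  exact weylConv_kernelSeries_inversion hα (tendsto_coeffs_neg_one_sub f) hs l

/-- After exchanging sums, `|b_j|` carries the weight `∑_{l ≤ j} k^α(j - l) = k^{α+1}(j)`,
restricted to `l < N`. Hence the absolute sum of the negative Fourier coefficients is bounded by the
norm of `A^α(𝕋)`. -/
lemma sum_norm_weylConv_le (hα : 0 < α) {b : ℕ → ℂ}
    (hb : Summable fun j => ‖b j‖ * genKernel (α + 1) j) (N : ℕ) :
    ∑ l ∈ range N, ‖weylConv (kernelSeries α) b l‖ ≤ ∑' j, ‖b j‖ * genKernel (α + 1) j := by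
  have hs : ∀ l, Summable fun i => genKernel α i * ‖b (l + i)‖ := fun l => by
    refine Summable.of_nonneg_of_le (fun i => mul_nonneg (genKernel_pos hα i).le (norm_nonneg _))
      (fun i => norm_genKernel_mul_le hα b l i) ?_
    simpa only [add_comm] using (summable_nat_add_iff l).2 hb
  have hle : ∀ l, ‖weylConv (kernelSeries α) b l‖ ≤ ∑' i, genKernel α i * ‖b (l + i)‖ :=
    fun l => tsum_of_norm_bounded (hs l).hasSum fun i => by
      rw [norm_mul, Complex.norm_real, coeff_kernelSeries,
        Real.norm_of_nonneg (genKernel_pos hα _).le]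
  have hshift : ∀ l, ∑' i, genKernel α i * ‖b (l + i)‖ =
      ∑' j, if l ≤ j then genKernel α (j - l) * ‖b j‖ else 0 := by
    intro l
    have hinj : Function.Injective fun i : ℕ => l + i := add_right_injective l
    rw [← hinj.tsum_eq (f := fun j => if l ≤ j then genKernel α (j - l) * ‖b j‖ else 0)]
    · exact tsum_congr fun i => by simp
    · intro j hj
      by_cases h : l ≤ j
      · exact ⟨j - l, by simp only; omega⟩
      · simp [h] at hj
  have hsum : ∀ l, Summable fun j => if l ≤ j then genKernel α (j - l) * ‖b j‖ else 0 := by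
    intro l
    have hinj : Function.Injective fun i : ℕ => l + i := add_right_injective l
    rw [← hinj.summable_iff]
    · exact (hs l).congr fun i => by simp [Function.comp]
    · intro j hj
      have : ¬ l ≤ j := fun h => hj ⟨j - l, by simp only; omega⟩
      simp [this]
  calc _ ≤ ∑ l ∈ range N, ∑' j, if l ≤ j then genKernel α (j - l) * ‖b j‖ else 0 :=
        sum_le_sum fun l _ => (hle l).trans_eq (hshift l)
    _ = ∑' j, ∑ l ∈ range N, if l ≤ j then genKernel α (j - l) * ‖b j‖ else 0 :=
        (Summable.tsum_finsetSum fun l _ => hsum l).symm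
    _ ≤ _ := by
        refine (summable_sum fun l _ => hsum l).tsum_le_tsum (fun j => ?_) hb
        rw [← sum_filter, mul_comm, ← sum_genKernel, sum_mul,
          ← sum_range_reflect (fun i => genKernel α i * ‖b j‖)]
        refine (sum_le_sum_of_subset_of_nonneg (t := range (j + 1)) (fun l hl => ?_)
          fun l _ _ => mul_nonneg (genKernel_pos hα _).le (norm_nonneg _)).trans_eq
          (sum_congr rfl fun l _ => by simp)
        rw [mem_filter] at hl
        exact mem_range.2 (by omega)

lemma MemWiener.sum_norm_coeffs_neg_le (hα : 0 < α) (hf : MemWiener α f) (N : ℕ) :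
    ∑ l ∈ range N, ‖coeffs f (-((l + 1 : ℕ) : ℤ))‖ ≤ wienerNorm α f := by
  obtain ⟨hs, hle⟩ := hf.summable_minus hα
  refine le_trans (le_of_eq (sum_congr rfl fun l _ => ?_)) ((sum_norm_weylConv_le hα hs N).trans hle)
  rw [hf.weylConv_minus hα]
  congr 2; push_cast; ring

end Wiener

/-! ### The Katznelson–Tzafriri theorem -/

section Main

variable {X : Type*} [NormedAddCommGroup X] [NormedSpace ℂ X] {α : ℝ} {T : X →L[ℂ] X}
  {f g : C(AddCircle (2 * Real.pi), ℂ)}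

lemma MemWiener.summable_norm_calculusTerm (hα : 0 < α) (hf : MemWiener α f) {K : ℝ}
    (h : ∀ n, ‖cesaroSum α T n‖ ≤ K * genKernel (α + 1) n) :
    (Summable fun n => ‖calculusTerm α T (coeffs f) n‖) ∧
      ‖calculus α T (coeffs f)‖ ≤ K * ∑' n : ℕ,
        ‖weylDiffPlus α (coeffs f) n‖ * genKernel (α + 1) n := by
  have hs := (hf.summable_plus hα).1
  have hle : ∀ n, ‖calculusTerm α T (coeffs f) n‖ ≤
      K * (‖weylDiffPlus α (coeffs f) n‖ * genKernel (α + 1) n) := by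
    intro n
    rw [calculusTerm, norm_smul]
    calc _ ≤ ‖weylDiffPlus α (coeffs f) n‖ * (K * genKernel (α + 1) n) := by gcongr; exact h n
      _ = _ := by ring
  exact ⟨Summable.of_nonneg_of_le (fun _ => norm_nonneg _) hle (hs.mul_left K),
    tsum_of_norm_bounded (hs.hasSum.mul_left K) hle⟩

/-- The power series `θ_α(f) + ∑_{d ≥ 1} f(-d) z^d`. -/
noncomputable def symbolSeries (α : ℝ) (T : X →L[ℂ] X) (f : C(AddCircle (2 * Real.pi), ℂ)) :
    PowerSeries (X →L[ℂ] X) :=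
  PowerSeries.mk fun n => if n = 0 then calculus α T (coeffs f)
    else coeffs f (-(n : ℤ)) • (1 : X →L[ℂ] X)

/-- The operator `Δ^{-α} 𝒯(n) θ_α(f) + ∑_{d=1}^n f(-d) Δ^{-α} 𝒯(n - d)`, the truncated product of
`Δ^{-α} 𝒯(n)` with an element of `A^α(𝕋)`. -/
noncomputable def truncatedProduct (α : ℝ) (T : X →L[ℂ] X)
    (f : C(AddCircle (2 * Real.pi), ℂ)) (n : ℕ) : X →L[ℂ] X :=
  coeff n (PowerSeries.mk (cesaroSum α T) * symbolSeries α T f)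

lemma truncatedProduct_of_memWienerPlus (hf : MemWienerPlus α f) (n : ℕ) :
    truncatedProduct α T f n = cesaroSum α T n * calculus α T (coeffs f) := by
  have : symbolSeries α T f = C (calculus α T (coeffs f)) := by
    ext1 n
    rw [symbolSeries, coeff_mk, coeff_C]
    split_ifs with hn
    · rfl
    · rw [hf.2 _ (by omega), zero_smul]
  rw [truncatedProduct, this, coeff_mul_C, coeff_mk]

/-- In the symbol, `θ_α(f)` contributes at most `K‖f‖` and the negative coefficients at most `‖f‖`,
whence `K + 1`; the remaining `K` bounds all Cesàro sums of index at most `n` by monotonicity of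
`k^{α+1}`. -/
lemma norm_truncatedProduct_le (hα : 0 < α) (hf : MemWiener α f) {K : ℝ} (hK : 0 ≤ K)
    (h : ∀ n, ‖cesaroSum α T n‖ ≤ K * genKernel (α + 1) n) (n : ℕ) :
    ‖truncatedProduct α T f n‖ ≤ K * (K + 1) * wienerNorm α f * genKernel (α + 1) n := by
  have hk := genKernel_pos (by linarith : 0 < α + 1) n
  have hsymb : ∑ m ∈ range (n + 1), ‖coeff m (symbolSeries α T f)‖ ≤
      (K + 1) * wienerNorm α f := by
    rw [sum_range_succ']
    have h1 : ∑ d ∈ range n, ‖coeff (d + 1) (symbolSeries α T f)‖ ≤ wienerNorm α f := by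
      refine le_trans (sum_le_sum fun d _ => ?_) (hf.sum_norm_coeffs_neg_le hα n)
      rw [symbolSeries, coeff_mk, if_neg d.succ_ne_zero, norm_smul]
      exact mul_le_of_le_one_right (norm_nonneg _) ContinuousLinearMap.norm_id_le
    have h2 : ‖coeff 0 (symbolSeries α T f)‖ ≤ K * wienerNorm α f := by
      rw [symbolSeries, coeff_mk, if_pos rfl]
      exact (hf.summable_norm_calculusTerm hα h).2.trans
        (mul_le_mul_of_nonneg_left (hf.summable_plus hα).2 hK)
    linarith
  calc ‖truncatedProduct α T f n‖
      ≤ ∑ p ∈ antidiagonal n, K * genKernel (α + 1) n * ‖coeff p.2 (symbolSeries α T f)‖ := by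
        rw [truncatedProduct, coeff_mul]
        refine norm_sum_le_of_le _ fun p hp => (norm_mul_le _ _).trans ?_
        rw [coeff_mk]
        gcongr
        refine (h _).trans (mul_le_mul_of_nonneg_left (monotone_genKernel_add_one hα ?_) hK)
        have := mem_antidiagonal.1 hp
        omega
    _ = K * genKernel (α + 1) n * ∑ m ∈ range (n + 1), ‖coeff m (symbolSeries α T f)‖ := by
        rw [← mul_sum, ← Nat.sum_antidiagonal_swap, Nat.sum_antidiagonal_eq_sum_range_succ_mk]
        rfl
    _ ≤ K * genKernel (α + 1) n * ((K + 1) * wienerNorm α f) := by gcongr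
    _ = _ := by ring

/-- The recursion says that `(1 - az)` times the series of `y` is `φ`. -/
lemma mk_eq_mk_pow_mul {R : Type*} [Ring R] {a : R} {y : ℕ → R} {φ : PowerSeries R}
    (h0 : y 0 = coeff 0 φ) (h : ∀ n, y (n + 1) = coeff (n + 1) φ + a * y n) :
    PowerSeries.mk y = PowerSeries.mk (fun n => a ^ n) * φ := by
  ext n
  rw [coeff_mk]
  induction n with
  | zero => simp [coeff_mul, h0]
  | succ n ih =>
    rw [h, ih, coeff_mul, coeff_mul, Nat.sum_antidiagonal_succ, mul_sum]
    simp [pow_succ', mul_assoc]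

variable [CompleteSpace X]

lemma symbolSeries_sub (hα : 0 < α) (hT : IsCesaroBounded α T) (hf : MemWiener α f)
    (hg : MemWiener α g) :
    symbolSeries α T (f - g) = symbolSeries α T f - symbolSeries α T g := by
  obtain ⟨K, hK, h⟩ := hT.exists_norm_cesaroSum_le hα
  ext1 n
  rw [map_sub]
  simp only [symbolSeries, coeff_mk]
  split_ifs with hn
  · rw [calculus, calculus, calculus,
      ← (hf.summable_norm_calculusTerm hα h).1.of_norm.tsum_sub
        (hg.summable_norm_calculusTerm hα h).1.of_norm]
    refine tsum_congr fun k => ?_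
    rw [calculusTerm, weylDiffPlus_sub hf hg, sub_smul]
    rfl
  · rw [coeffs_sub, sub_smul]

/-- Factor the Cesàro series as `(1 - z)^{-α}(1 - zT)^{-1}`; the second factor times the symbol is
the series of Fourier coefficients of `G`. -/
lemma truncatedProduct_eq_sum (hα : 0 < α) (hT : IsCesaroBounded α T) (hg : MemWiener α g)
    (hE : ∀ᶠ t in 𝓝ˢ (unitarySpectrum T), g t = 0) (n : ℕ) :
    truncatedProduct α T g n = ∑ p ∈ antidiagonal n,
      (genKernel α p.1 : ℂ) • fourierCoeff (resolventMul T g 1) (-(p.2 : ℤ)) := by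
  have hy : PowerSeries.mk (fun j : ℕ => fourierCoeff (resolventMul T g 1) (-(j : ℤ))) =
      PowerSeries.mk (fun n => T ^ n) * symbolSeries α T g := by
    refine mk_eq_mk_pow_mul ?_ fun j => ?_
    · rw [symbolSeries, coeff_mk, if_pos rfl, Nat.cast_zero, neg_zero,
        fourierCoeff_resolventMul_zero hα hT hE (hg.summable_plus hα).1 (hg.weylConv_plus hα)]
      rfl
    · rw [symbolSeries, coeff_mk, if_neg j.succ_ne_zero]
      exact fourierCoeff_resolventMul_succ hα hT hE j
  rw [truncatedProduct, mk_cesaroSum hα, mul_assoc, ← hy, coeff_toOperatorSeries_mul]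
  simp only [coeff_mk, coeff_kernelSeries]

lemma tendsto_truncatedProduct (hα : 0 < α) (hT : IsCesaroBounded α T) (hg : MemWiener α g)
    (hE : ∀ᶠ t in 𝓝ˢ (unitarySpectrum T), g t = 0) :
    Tendsto (fun n => ‖truncatedProduct α T g n‖ / genKernel (α + 1) n) atTop (𝓝 0) := by
  have hinj : Function.Injective fun n : ℕ => -(n : ℤ) := fun a b h => by
    simp only at h; omega
  have hRL : Tendsto (fun j : ℕ => ‖fourierCoeff (resolventMul T g 1) (-(j : ℤ))‖) atTop
      (𝓝 0) := by
    rw [← Nat.cofinite_eq_atTop, tendsto_zero_iff_norm_tendsto_zero]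
    simpa using ((tendsto_fourierCoeff_cofinite (resolventMul T g 1)).comp
      hinj.tendsto_cofinite).norm
  have hk := fun n => genKernel_pos (by linarith : 0 < α + 1) n
  refine squeeze_zero (fun n => div_nonneg (norm_nonneg _) (hk n).le) (fun n => ?_)
    (tendsto_genKernel_average hα (fun _ => norm_nonneg _) hRL)
  refine div_le_div_of_nonneg_right ?_ (hk n).le
  rw [truncatedProduct_eq_sum hα hT hg hE, ← Nat.sum_antidiagonal_swap,
    Nat.sum_antidiagonal_eq_sum_range_succ_mk]
  refine norm_sum_le_of_le _ fun j _ => ?_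
  rw [norm_smul, Complex.norm_real, Real.norm_of_nonneg (genKernel_pos hα _).le]
  rfl

end Main

end CesaroKT

open CesaroKT in
theorem mainTheorem1 {X : Type*} [NormedAddCommGroup X] [NormedSpace ℂ X] [CompleteSpace X]
    (α : ℝ) (hα : 0 < α) (T : X →L[ℂ] X) (hT : CesaroKT.IsCesaroBounded α T)
    (f : C(AddCircle (2 * Real.pi), ℂ)) (hf : CesaroKT.MemWienerPlus α f)
    (hsyn : CesaroKT.IsOfSpectralSynthesis α (CesaroKT.unitarySpectrum T) f) :
    Summable (CesaroKT.calculusTerm α T (CesaroKT.coeffs f)) ∧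
      Filter.Tendsto
        (fun n : ℕ => ‖CesaroKT.cesaroMean α T n * CesaroKT.calculus α T (CesaroKT.coeffs f)‖)
        Filter.atTop (𝓝 0) := by
  obtain ⟨K, hK, h⟩ := hT.exists_norm_cesaroSum_le hα
  refine ⟨(hf.1.summable_norm_calculusTerm hα h).1.of_norm, ?_⟩
  have hk := fun n => genKernel_pos (by linarith : 0 < α + 1) n
  have heq : ∀ n, ‖cesaroMean α T n * calculus α T (coeffs f)‖ =
      ‖truncatedProduct α T f n‖ / genKernel (α + 1) n := by
    intro n
    rw [truncatedProduct_of_memWienerPlus hf, cesaroMean, smul_mul_assoc, norm_smul, norm_div,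
      norm_one, Complex.norm_real, cesaroKernel_eq_genKernel (by linarith),
      Real.norm_of_nonneg (hk n).le, one_div_mul_eq_div]
  simp only [heq]
  -- The added 1 keeps the divisor of the approximation error positive when `K = 0`.
  have hK' : 0 < K * (K + 1) + 1 := by positivity
  rw [Metric.tendsto_atTop]
  intro ε hε
  obtain ⟨g, hg, hfg, hE⟩ := hsyn.2 (ε / 2 / (K * (K + 1) + 1)) (by positivity)
  obtain ⟨N, hN⟩ := Filter.eventually_atTop.1
    ((tendsto_truncatedProduct hα hT hg hE).eventually (gt_mem_nhds (half_pos hε)))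
  refine ⟨N, fun n hn => ?_⟩
  rw [Real.dist_eq, sub_zero, abs_of_nonneg (div_nonneg (norm_nonneg _) (hk n).le)]
  -- The first summand is small by the norm bound, uniformly in `n` after division by `k^{α+1}(n)`;
  -- the second tends to zero after the same division.
  have hsub : truncatedProduct α T f n =
      truncatedProduct α T (f - g) n + truncatedProduct α T g n := by
    simp only [truncatedProduct]
    rw [symbolSeries_sub hα hT hf.1 hg, mul_sub, map_sub, sub_add_cancel]
  have h1 : ‖truncatedProduct α T (f - g) n‖ / genKernel (α + 1) n ≤ ε / 2 := by
    rw [div_le_iff₀ (hk n)]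
    refine (norm_truncatedProduct_le hα (hf.1.sub hα hg) hK h n).trans
      (mul_le_mul_of_nonneg_right ?_ (hk n).le)
    calc K * (K + 1) * wienerNorm α (f - g)
        ≤ K * (K + 1) * (ε / 2 / (K * (K + 1) + 1)) := by gcongr
      _ ≤ (K * (K + 1) + 1) * (ε / 2 / (K * (K + 1) + 1)) := by
          gcongr
          linarith
      _ = ε / 2 := by field_simp
  calc ‖truncatedProduct α T f n‖ / genKernel (α + 1) n
      ≤ ‖truncatedProduct α T (f - g) n‖ / genKernel (α + 1) n +
          ‖truncatedProduct α T g n‖ / genKernel (α + 1) n := by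
        rw [← add_div, hsub]
        exact div_le_div_of_nonneg_right (norm_add_le _ _) (hk n).le
    _ < ε := by linarith [hN n hn]
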